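/- **Setting.** Let $\Delta$ be a countably infinite set of constants. Every predicate symbol is either a CWA-predicate symbol or an OWA-predicate symbol. Let $\sigma_D$ be an effectively given database signature (predicate symbols and the constants of $\Delta$) and $\sigma_Q$ a query signature (OWA-predicate symbols, function symbols, and the constants of $\Delta$). Finite objects $x$ are encoded effectively and injectively by strings $\langle x\rangle\in\{0,1\}^*$. Turing machines are represented by the programs of a standard universal programming system for the partial recursive functions, and a machine accepts an input if it halts on it with answer "yes". A *database* is a partial function $D$ from the variable- and equality-free atoms of $\sigma_D$ to $\{1,0,-1\}$ which has a value $\ge 0$ at finitely many atoms only, is defined at every CWA-atom (atom of a CWA-predicate symbol), and is defined at finitely many OWA-atoms only. It is *positive* if it never has the value $0$. For injective $\tau:\Delta\to\Delta$, the database $\tau(D)$ has the value $D(\alpha)$ at $\tau(\alpha)$, the value $-1$ at the CWA-atoms that are not of the form $\tau(\alpha)$, and is undefined at the other OWA-atoms; $\tau(\phi)$ is obtained from the sentence $\phi$ by replacing each constant $c\in\Delta$ by $\tau(c)$. Let $\mathscr D$ be the class of all databases or the class of all positive databases. Let $\mathscr Q$ be a *query language*: a recursive class of first-order sentences of $\sigma_Q$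 that is closed under conjunctions and under injective renamings of constants and contains a sentence that is not a tautology. A *knowledge base (KB)* over $(\mathscr D,\mathscr Q)$ is a class $K\subseteq\mathscr D\times\mathscr Q$ such that: (1) $(D,\phi)\in K$ for every $D\in\mathscr D$ and every tautology $\phi\in\mathscr Q$; (2) if $(D,\phi)\in K$, $\psi\in\mathscr Q$ and $\phi\vDash\psi$, then $(D,\psi)\in K$; (3) if $(D,\phi),(D,\psi)\in K$, then $(D,\phi\wedge\psi)\in K$; (4) if $(D,\phi)\in K$ and $D_0\in\mathscr D$ extends $D$ as a partial function, then $(D_0,\phi)\in K$; (5) if $(D,\phi)\in K$ and $\tau:\Delta\to\Delta$ is injective, then $(\tau(D),\tau(\phi))\in K$. A *knowledge representation formalism (KRF)* over $(\mathscr D,\mathscr Q)$ is a mapping $\Gamma$ from a recursive set $\mathrm{dom}(\Gamma)\subseteq\{0,1\}^*$ to the KBs over $(\mathscr D,\mathscr Q)$ such that it is recursively enumerable to check, given $\pi\in\mathrm{dom}(\Gamma)$, $D\in\mathscr D$ and $\phi\in\mathscr Q$, whether $(D,\phi)\in\Gamma(\pi)$. A KRF $\Gamma$ is *reducible* to a KRF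 $\Gamma_0$ if there is a recursive function $p:\mathrm{dom}(\Gamma)\to\mathrm{dom}(\Gamma_0)$ with $\Gamma=\Gamma_0\circ p$, and $\Gamma$ is *universal* if every KRF over $(\mathscr D,\mathscr Q)$ is reducible to $\Gamma$. **The canonical KRF.** For a machine $M$ consider the recursive procedure which, on input $D\in\mathscr D$ and $\phi\in\mathscr Q$, accepts if and only if one of the following holds (after finitely many recursive calls): (i) $M$ accepts $\langle D,\phi\rangle$; (ii) $\phi$ is a tautology; (iii) the procedure accepts $(D,\psi)$ for some $\psi\in\mathscr Q$ with $\psi\vDash\phi$; (iv) $\phi=\psi\wedge\chi$ with $\psi,\chi\in\mathscr Q$ and the procedure accepts $(D,\psi)$ and $(D,\chi)$; (v) the procedure accepts $(D',\phi)$ for some $D'\in\mathscr D$ such that $D$ extends $D'$; (vi) the procedure accepts $(\tau(D),\tau(\phi))$ for some injective $\tau:\Delta\to\Delta$. Let $U$ be a program with two inputs that implements this procedure: on $M$ and $\langle D,\phi\rangle$ it accepts if and only if the procedure for $M$ accepts $(D,\phi)$. Let $M^*$ be the machine obtained from $U$ by hard-wiring its first input to be $M$, and let $\Theta$ be the mapping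 with domain $\{\langle M^*\rangle : M \text{ a machine}\}$ which maps $\langle M^*\rangle$ to $\{(D,\phi)\in\mathscr D\times\mathscr Q : M^*\text{ accepts }\langle D,\phi\rangle\}$. **Statement.** A program $U$ as above exists. For every such $U$, the mapping $\Theta$ is a KRF over $(\mathscr D,\mathscr Q)$, and a KRF $\Gamma$ over $(\mathscr D,\mathscr Q)$ is universal if and only if $\Theta$ is reducible to $\Gamma$. -/

import Mathlib

namespace KRep

open FirstOrder

/-! ### Strings and machines -/

/-- The string in `{0,1}*` that represents the natural number code of a finite object. -/
def str (n : ℕ) : List Bool := Nat.bits n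

/-- Machines: the programs of Mathlib's standard model of computation. -/
abbrev Machine := Nat.Partrec.Code

/-- `M` accepts the input `w`: it halts on `w` with the answer "yes", which is the output `1`. -/
def Accepts (M : Machine) (w : List Bool) : Prop := 1 ∈ M.eval (Encodable.encode w)

/-- The string that encodes a machine. -/
def machineStr (M : Machine) : List Bool := str (Encodable.encode M)

/-! ### Signatures -/

/-- The fixed countably infinite set `Δ` of constants. -/
abbrev Const := ℕ

/-- A database signature and a query signature over `Δ`. A predicate or function symbol is a pair
`(n, i)`: the symbol number `i` of arity `n`. The constants of both signatures are those of `Δ`. -/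
structure Signatures where
  /-- The CWA-predicate symbols; all other predicate symbols are OWA-predicate symbols. -/
  cwa : Set (ℕ × ℕ)
  /-- The predicate symbols of the database signature. -/
  dbPreds : Set (ℕ × ℕ)
  /-- The predicate symbols of the query signature. -/
  qPreds : Set (ℕ × ℕ)
  /-- The function symbols of positive arity of the query signature. -/
  qFuncs : Set (ℕ × ℕ)
  /-- The database signature is effectively given. -/
  cwa_recursive : ComputablePred (fun p : ℕ × ℕ => p ∈ cwa)
  dbPreds_recursive : ComputablePred (fun p : ℕ × ℕ => p ∈ dbPreds)
  /-- The query signature has no CWA-predicate symbol. -/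
  qPreds_owa : ∀ p ∈ qPreds, p ∉ cwa

variable {S : Signatures}

/-! ### Databases -/

/-- Atoms of the database signature without variables and equality. -/
@[ext] structure Fact (S : Signatures) where
  pred : ℕ × ℕ
  args : List Const
  pred_mem : pred ∈ S.dbPreds
  length_eq : args.length = pred.1

/-- The predicate of the atom is a CWA-predicate. -/
def Fact.IsCWA (α : Fact S) : Prop := α.pred ∈ S.cwa

/-- Renaming of the constants of an atom. -/
def Fact.rename (τ : Const → Const) (α : Fact S) : Fact S where
  pred := α.pred
  args := α.args.map τ
  pred_mem := α.pred_mem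
  length_eq := by rw [List.length_map, α.length_eq]

/-- A database: a partial function from atoms to `{1, 0, -1}`. -/
@[ext] structure Database (S : Signatures) where
  val : Fact S → Option SignType
  /-- Finiteness of observation. -/
  finite_observed : {α | ∃ v, val α = some v ∧ 0 ≤ v}.Finite
  /-- Completeness of CWA-predicates. -/
  cwa_complete : ∀ α, α.IsCWA → ∃ v, val α = some v
  /-- A database is a finite object: it is defined on finitely many OWA-atoms only. -/
  finite_owa : {α | ¬ α.IsCWA ∧ ∃ v, val α = some v}.Finite

/-- `D₀` extends `D` as a partial function. -/
def Database.Extends (D₀ D : Database S) : Prop :=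
  ∀ α v, D.val α = some v → D₀.val α = some v

/-- No negative fact is observed. -/
def Database.IsPositive (D : Database S) : Prop := ∀ α, D.val α ≠ some 0

open Classical in
/-- Renaming of the constants of a database: `τ(D)` has the value `D(α)` at `τ(α)`; CWA-atoms that
are not of the form `τ(α)` are not observed and hence have the value `-1`. Used for injective `τ`
only, so that `α` is determined by `τ(α)`. -/
noncomputable def Database.renameVal (τ : Const → Const) (D : Database S) (β : Fact S) :
    Option SignType :=
  if h : ∃ α : Fact S, α.rename τ = β then D.val h.choose
  else if β.IsCWA then some (-1) else none

theorem Database.renameVal_eq (τ : Const → Const) (D : Database S) (β : Fact S) :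
    (∃ α : Fact S, α.rename τ = β ∧ D.renameVal τ β = D.val α) ∨
    (β.IsCWA ∧ D.renameVal τ β = some (-1)) ∨ (¬ β.IsCWA ∧ D.renameVal τ β = none) := by
  unfold Database.renameVal
  by_cases h : ∃ α : Fact S, α.rename τ = β
  · left
    exact ⟨h.choose, h.choose_spec, by rw [dif_pos h]⟩
  · right
    rw [dif_neg h]
    by_cases hc : β.IsCWA
    · exact Or.inl ⟨hc, if_pos hc⟩
    · exact Or.inr ⟨hc, if_neg hc⟩

/-- The database `τ(D)`. -/
noncomputable def Database.rename (τ : Const → Const) (D : Database S) : Database S where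
  val := D.renameVal τ
  finite_observed := by
    refine (D.finite_observed.image (Fact.rename τ)).subset ?_
    rintro β ⟨v, hv, h0⟩
    rcases D.renameVal_eq τ β with ⟨α, rfl, h⟩ | ⟨-, h⟩ | ⟨-, h⟩
    · exact ⟨α, ⟨v, h ▸ hv, h0⟩, rfl⟩
    · rw [h] at hv
      cases hv
      exact absurd h0 (by decide)
    · rw [h] at hv
      cases hv
  cwa_complete := by
    intro β hβ
    rcases D.renameVal_eq τ β with ⟨α, rfl, h⟩ | ⟨-, h⟩ | ⟨hn, -⟩
    · rw [h]
      exact D.cwa_complete α hβ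
    · exact ⟨_, h⟩
    · exact absurd hβ hn
  finite_owa := by
    refine (D.finite_owa.image (Fact.rename τ)).subset ?_
    rintro β ⟨hβ, v, hv⟩
    rcases D.renameVal_eq τ β with ⟨α, rfl, h⟩ | ⟨hc, -⟩ | ⟨-, h⟩
    · exact ⟨α, ⟨hβ, v, h ▸ hv⟩, rfl⟩
    · exact absurd hc hβ
    · rw [h] at hv
      cases hv

/-- The class of arbitrary databases. -/
def allDatabases (S : Signatures) : Set (Database S) := Set.univ

/-- The class of positive databases. -/
def positiveDatabases (S : Signatures) : Set (Database S) := {D | D.IsPositive}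

/-- The code of the statement that the atom `α` has the value `v`. -/
def Fact.code (α : Fact S) (v : SignType) : ℕ :=
  Encodable.encode (α.pred, α.args, (if v = 1 then 2 else if v = 0 then 1 else 0 : ℕ))

/-- The codes of the finitely many pairs `(α, v)` with `D(α) = v` that determine `D`: all except
those with `v = -1` where `α` is a CWA-atom. -/
def Database.entries (D : Database S) : Set ℕ :=
  {n | ∃ α v, D.val α = some v ∧ (0 ≤ v ∨ ¬ α.IsCWA) ∧ n = α.code v}

theorem Database.entries_finite (D : Database S) : D.entries.Finite := by
  refine (((D.finite_observed.union D.finite_owa).prod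
    (Set.toFinite (Set.univ : Set SignType))).image (fun x => Fact.code x.1 x.2)).subset ?_
  rintro n ⟨α, v, hv, h | h, rfl⟩
  · exact ⟨(α, v), ⟨Or.inl ⟨v, hv, h⟩, trivial⟩, rfl⟩
  · exact ⟨(α, v), ⟨Or.inr ⟨h, v, hv⟩, trivial⟩, rfl⟩

/-- The code of a database: the code of the increasing list of its entries. -/
noncomputable def Database.code (D : Database S) : ℕ :=
  Encodable.encode (D.entries_finite.toFinset.sort (· ≤ ·))

/-! ### Queries -/

/-- The query signature as a first-order language. Its constants are the elements of `Δ`. -/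
def qLang (S : Signatures) : FirstOrder.Language.{0, 0} where
  Functions n := {i : ℕ // n = 0 ∨ (n, i) ∈ S.qFuncs}
  Relations n := {i : ℕ // (n, i) ∈ S.qPreds}

/-- First-order sentences of the query signature. -/
abbrev Query (S : Signatures) := (qLang S).Sentence

/-- The language map that renames each constant `c` to `τ c`. -/
def renameHom (S : Signatures) (τ : Const → Const) : qLang S →ᴸ qLang S where
  onFunction := fun {n} f => ⟨if n = 0 then τ f.1 else f.1, by
    by_cases h : n = 0
    · exact Or.inl h
    · rw [if_neg h]
      exact f.2⟩
  onRelation := fun {_} r => r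

/-- The sentence `τ(φ)`. -/
def renameQuery (τ : Const → Const) (φ : Query S) : Query S := (renameHom S τ).onSentence φ

/-- `φ` holds in all (nonempty) structures. -/
def IsTautology (φ : Query S) : Prop := (∅ : (qLang S).Theory) ⊨ᵇ φ

/-- `φ` logically implies `ψ`. -/
def Implies (φ ψ : Query S) : Prop := ({φ} : (qLang S).Theory) ⊨ᵇ ψ

/-- Terms as strings of tokens in Polish notation. -/
def termTokens {n : ℕ} : (qLang S).Term (Empty ⊕ Fin n) → List (ℕ × ℕ × ℕ)
  | .var (.inr i) => [(0, 0, i)]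
  | .func (l := k) f ts => (1, k, f.1) :: (List.ofFn fun i => termTokens (ts i)).flatten

/-- Formulas as strings of tokens in Polish notation. -/
def formulaTokens : {n : ℕ} → (qLang S).BoundedFormula Empty n → List (ℕ × ℕ × ℕ)
  | _, .falsum => [(2, 0, 0)]
  | _, .equal t u => (3, 0, 0) :: (termTokens t ++ termTokens u)
  | _, .rel (l := k) R ts => (4, k, R.1) :: (List.ofFn fun i => termTokens (ts i)).flatten
  | _, .imp φ ψ => (5, 0, 0) :: (formulaTokens φ ++ formulaTokens ψ)
  | _, .all φ => (6, 0, 0) :: formulaTokens φ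

/-- The code of a sentence. -/
def queryCode (φ : Query S) : ℕ := Encodable.encode (formulaTokens φ)

/-- The string that encodes a sentence. -/
def queryStr (φ : Query S) : List Bool := str (queryCode φ)

/-- The string that encodes a pair of a database and a sentence. -/
noncomputable def pairStr (D : Database S) (φ : Query S) : List Bool :=
  str (Nat.pair D.code (queryCode φ))

/-- Query languages. -/
structure IsQueryLanguage (Q : Set (Query S)) : Prop where
  recursive : ComputablePred (fun w : List Bool => ∃ φ ∈ Q, queryStr φ = w)
  conj : ∀ φ ∈ Q, ∀ ψ ∈ Q, φ ⊓ ψ ∈ Q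
  rename : ∀ τ : Const → Const, Function.Injective τ → ∀ φ ∈ Q, renameQuery τ φ ∈ Q
  nontautological : ∃ φ ∈ Q, ¬ IsTautology φ

/-! ### Knowledge bases and formalisms -/

variable (𝒟 : Set (Database S)) (Q : Set (Query S))

/-- Knowledge bases over `(𝒟, Q)`. -/
structure IsKB (K : Set (Database S × Query S)) : Prop where
  subclass : K ⊆ 𝒟 ×ˢ Q
  tautology : ∀ D ∈ 𝒟, ∀ φ ∈ Q, IsTautology φ → (D, φ) ∈ K
  implication : ∀ D φ, (D, φ) ∈ K → ∀ ψ ∈ Q, Implies φ ψ → (D, ψ) ∈ K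
  conj : ∀ D φ ψ, (D, φ) ∈ K → (D, ψ) ∈ K → (D, φ ⊓ ψ) ∈ K
  extension : ∀ D φ, (D, φ) ∈ K → ∀ D₀ ∈ 𝒟, D₀.Extends D → (D₀, φ) ∈ K
  rename : ∀ τ : Const → Const, Function.Injective τ →
    ∀ D φ, (D, φ) ∈ K → (D.rename τ, renameQuery τ φ) ∈ K

/-- Knowledge representation formalisms over `(𝒟, Q)`: partial mappings from strings to knowledge
bases. -/
structure IsKRF (Γ : List Bool →. Set (Database S × Query S)) : Prop where
  dom_recursive : ComputablePred (fun π : List Bool => (Γ π).Dom)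
  kb : ∀ π K, K ∈ Γ π → IsKB 𝒟 Q K
  re : REPred (fun x : List Bool × List Bool =>
    ∃ D ∈ 𝒟, ∃ φ ∈ Q, x.2 = pairStr D φ ∧ ∃ K ∈ Γ x.1, (D, φ) ∈ K)

/-- `Γ` is reducible to `Γ₀`: there is a recursive function `p : dom(Γ) → dom(Γ₀)` such that
`Γ = Γ₀ ∘ p`. -/
def ReducibleTo (Γ Γ₀ : List Bool →. Set (Database S × Query S)) : Prop :=
  ∃ p : List Bool →. List Bool,
    Partrec p ∧ ComputablePred (fun π => (p π).Dom) ∧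
    (∀ π, (p π).Dom ↔ (Γ π).Dom) ∧ (∀ π, ∀ ω ∈ p π, (Γ₀ ω).Dom) ∧
    Γ = Γ₀.comp p

/-- Universal knowledge representation formalisms over `(𝒟, Q)`. -/
def IsUniversal (Γ : List Bool →. Set (Database S × Query S)) : Prop :=
  IsKRF 𝒟 Q Γ ∧ ∀ Γ', IsKRF 𝒟 Q Γ' → ReducibleTo Γ' Γ

/-! ### The canonical formalism -/

/-- The class of database-query pairs that the machine `M` accepts. -/
def machineKB (M : Machine) : Set (Database S × Query S) :=
  {x | x.1 ∈ 𝒟 ∧ x.2 ∈ Q ∧ Accepts M (pairStr x.1 x.2)}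

/-- The recursive procedure performed by `M*` on a database and a query, in terms of `M`: the input
is accepted if and only if one of the following six checks succeeds (after finitely many recursive
calls). -/
inductive ProcedureAccepts (M : Machine) : Database S → Query S → Prop
  | simulate (D : Database S) (φ : Query S) :
      Accepts M (pairStr D φ) → ProcedureAccepts M D φ
  | tautology (D : Database S) (φ : Query S) :
      IsTautology φ → ProcedureAccepts M D φ
  | implication (D : Database S) (φ ψ : Query S) :
      ψ ∈ Q → Implies ψ φ → ProcedureAccepts M D ψ → ProcedureAccepts M D φ
  | conj (D : Database S) (ψ χ : Query S) :
      ψ ∈ Q → χ ∈ Q → ProcedureAccepts M D ψ → ProcedureAccepts M D χ →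
      ProcedureAccepts M D (ψ ⊓ χ)
  | extension (D D' : Database S) (φ : Query S) :
      D' ∈ 𝒟 → D.Extends D' → ProcedureAccepts M D' φ → ProcedureAccepts M D φ
  | rename (τ : Const → Const) (D : Database S) (φ : Query S) :
      Function.Injective τ → ProcedureAccepts M (D.rename τ) (renameQuery τ φ) →
      ProcedureAccepts M D φ

/-- Given a program `U` with two inputs, a machine and a string, `M*` is the machine obtained from
`U` by hard-wiring its first input to be `M`. -/
def star (U M : Machine) : Machine := U.curry (Encodable.encode M)

/-- The program `U` implements the procedure. -/
def Implements (U : Machine) : Prop :=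
  ∀ M : Machine, ∀ D ∈ 𝒟, ∀ φ ∈ Q,
    (Accepts (star U M) (pairStr D φ) ↔ ProcedureAccepts 𝒟 Q M D φ)

/-- The mapping `Θ` which maps the string that encodes `M*` to the class of pairs accepted by `M*`,
for every machine `M`. -/
noncomputable def Theta (U : Machine) : List Bool →. Set (Database S × Query S) :=
  fun w => ⟨∃ M : Machine, machineStr (star U M) = w,
    fun h => machineKB 𝒟 Q (star U h.choose)⟩

end KRep

-- Existence of `U`. The procedure generates a least set closed under six rules, so it suffices that
-- each rule is recursively enumerable in terms of codes: a derivation is then a finite object whose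
-- correctness can be confirmed effectively (`rePred_generated`). Two points need an argument. Rules
-- (ii) and (iii) ask for the enumerability of logical validity and implication. Rule (vi)
-- quantifies over all injections of `Δ`, but a database and a sentence involve only finitely many
-- constants, so injections given by finite lists suffice (`exists_listRename`).
--
-- Validity is handled by a Herbrand argument. A fixed recursively enumerable set of propositional
-- clauses describes the truth of strings in Polish notation, equality, and Skolem witnesses for the
-- universal quantifier. A valuation satisfying the clauses yields a structure on a quotient of `ℕ`
-- (`IsHerbrandModel.truthVar_iff_models`), and every nonempty structure induces such a valuation
-- (`exists_isHerbrandModel`). Hence implication is propositional unsatisfiability, which semantic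
-- trees detect by compactness (`exists_valuation`, `implies_iff_refutable`).
--
-- `Θ` is a KRF. The closure conditions of a KB are the rules of the procedure, except that rule
-- (vi) passes from `τ(D), τ(φ)` back to `D, φ`, whereas a KB must be closed in the forward
-- direction. An injective `ρ` that undoes `τ` on the relevant constants exchanges the two
-- (`exists_rename_leftInverse`). The domain of `Θ` is recursive because the code of `M*` bounds
-- that of `M`.
--
-- Universality. Given a KRF `Γ`, hard-wiring `π` into an enumeration of `Γ` yields a machine `N π`
-- that accepts exactly the pairs in `Γ(π)`. That class is already closed under the rules, so `(N
-- π)*` accepts the same pairs and `π ↦ ⟨(N π)*⟩` is a reduction to `Θ` (`IsKRF.reducibleTo_theta`).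
-- The equivalence follows by transitivity of reducibility.
--
-- Sentences are handled only up to equality of their token strings. Such sentences are equivalent,
-- so closure under implication bridges the difference and the injectivity of the coding of
-- sentences is never needed.

attribute [fun_prop] Primrec
attribute [fun_prop] Primrec.id Primrec.const Primrec.comp Primrec.pair Primrec.fst Primrec.snd

namespace KRep

open FirstOrder

variable {S : Signatures}

/-! ### Primitive recursive functions in compositional form -/

section Primitive

variable {α β γ σ : Type*} [Primcodable α] [Primcodable β] [Primcodable γ] [Primcodable σ]

@[fun_prop] theorem primrec_fst {f : α → β × γ} (hf : Primrec f) : Primrec fun x => (f x).1 :=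
  Primrec.fst.comp hf

@[fun_prop] theorem primrec_snd {f : α → β × γ} (hf : Primrec f) : Primrec fun x => (f x).2 :=
  Primrec.snd.comp hf

@[fun_prop] theorem primrec_cons {f : α → β} {g : α → List β} (hf : Primrec f) (hg : Primrec g) :
    Primrec fun x => f x :: g x := Primrec.list_cons.comp hf hg

@[fun_prop] theorem primrec_append {f g : α → List β} (hf : Primrec f) (hg : Primrec g) :
    Primrec fun x => f x ++ g x := Primrec.list_append.comp hf hg

@[fun_prop] theorem primrec_map {f : α → List β} {g : α → β → γ} (hf : Primrec f)
    (hg : Primrec fun x : α × β => g x.1 x.2) : Primrec fun x => (f x).map (g x) :=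
  Primrec.list_map hf hg

@[fun_prop] theorem primrec_drop {f : α → ℕ} {g : α → List β} (hf : Primrec f) (hg : Primrec g) :
    Primrec fun x => (g x).drop (f x) := Primrec.list_drop.comp hf hg

@[fun_prop] theorem primrec_take {f : α → ℕ} {g : α → List β} (hf : Primrec f) (hg : Primrec g) :
    Primrec fun x => (g x).take (f x) := Primrec.list_take.comp hf hg

@[fun_prop] theorem primrec_length {g : α → List β} (hg : Primrec g) :
    Primrec fun x => (g x).length := Primrec.list_length.comp hg

@[fun_prop] theorem primrec_range {g : α → ℕ} (hg : Primrec g) :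
    Primrec fun x => List.range (g x) := Primrec.list_range.comp hg

@[fun_prop] theorem primrec_list_getD {f : α → List β} {g : α → ℕ} {h : α → β}
    (hf : Primrec f) (hg : Primrec g) (hh : Primrec h) :
    Primrec fun x => (f x).getD (g x) (h x) := by
  have h1 : Primrec fun x => ((f x)[g x]?).getD (h x) :=
    Primrec.option_getD.comp (Primrec.list_getElem?.comp hf hg) hh
  exact h1.of_eq fun x => by simp

@[fun_prop] theorem primrec_list_headI [Inhabited β] {f : α → List β} (hf : Primrec f) :
    Primrec fun x => (f x).headI := Primrec.list_headI.comp hf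

@[fun_prop] theorem primrec_option_getD {f : α → Option β} {h : α → β}
    (hf : Primrec f) (hh : Primrec h) :
    Primrec fun x => (f x).getD (h x) := Primrec.option_getD.comp hf hh

@[fun_prop] theorem primrec_foldr {f : α → List β} {g : α → σ} {h : α → β → σ → σ}
    (hf : Primrec f) (hg : Primrec g) (hh : Primrec fun x : α × β × σ => h x.1 x.2.1 x.2.2) :
    Primrec fun x => (f x).foldr (h x) (g x) :=
  Primrec.list_foldr (h := fun a p => h a p.1 p.2) hf hg hh

@[fun_prop] theorem primrec_add {f g : α → ℕ} (hf : Primrec f) (hg : Primrec g) :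
    Primrec fun x => f x + g x := Primrec.nat_add.comp hf hg

@[fun_prop] theorem primrec_mul {f g : α → ℕ} (hf : Primrec f) (hg : Primrec g) :
    Primrec fun x => f x * g x := Primrec.nat_mul.comp hf hg

@[fun_prop] theorem primrec_natPair {f g : α → ℕ} (hf : Primrec f) (hg : Primrec g) :
    Primrec fun x => Nat.pair (f x) (g x) := Primrec₂.natPair.comp hf hg

@[fun_prop] theorem primrec_unpair {f : α → ℕ} (hf : Primrec f) :
    Primrec fun x => Nat.unpair (f x) := Primrec.unpair.comp hf

@[fun_prop] theorem primrec_encode {f : α → β} (hf : Primrec f) :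
    Primrec fun x => Encodable.encode (f x) := Primrec.encode.comp hf

@[fun_prop] theorem primrec_decode {f : α → ℕ} (hf : Primrec f) :
    Primrec fun x => (Encodable.decode (f x) : Option β) := Primrec.decode.comp hf

@[fun_prop] theorem primrec_inl {f : α → β} (hf : Primrec f) :
    Primrec fun x => (Sum.inl (f x) : β ⊕ γ) := Primrec.sumInl.comp hf

@[fun_prop] theorem primrec_inr {f : α → γ} (hf : Primrec f) :
    Primrec fun x => (Sum.inr (f x) : β ⊕ γ) := Primrec.sumInr.comp hf

@[fun_prop] theorem primrec_not {f : α → Bool} (hf : Primrec f) :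
    Primrec fun x => !(f x) := Primrec.not.comp hf

@[fun_prop] theorem primrec_ite {c : α → Prop} [DecidablePred c] {f g : α → σ}
    (hc : PrimrecPred c) (hf : Primrec f) (hg : Primrec g) :
    Primrec fun x => if c x then f x else g x := Primrec.ite hc hf hg

theorem primrecPred_eq {f g : α → β} (hf : Primrec f) (hg : Primrec g) :
    PrimrecPred fun x => f x = g x := Primrec.eq.comp hf hg

theorem primrecPred_lt {f g : α → ℕ} (hf : Primrec f) (hg : Primrec g) :
    PrimrecPred fun x => f x < g x := Primrec.nat_lt.comp hf hg

theorem primrecPred_exists_mem {f : α → List β} {p : α → β → Prop} (hf : Primrec f)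
    (hp : PrimrecPred fun x : α × β => p x.1 x.2) : PrimrecPred fun x => ∃ b ∈ f x, p x b :=
  PrimrecRel.comp (PrimrecRel.exists_mem_list (R := fun b a => p a b)
    (hp.comp (Primrec.snd.pair Primrec.fst))) hf Primrec.id

theorem primrecPred_forall_mem {f : α → List β} {p : α → β → Prop} (hf : Primrec f)
    (hp : PrimrecPred fun x : α × β => p x.1 x.2) : PrimrecPred fun x => ∀ b ∈ f x, p x b :=
  PrimrecRel.comp (PrimrecRel.forall_mem_list (R := fun b a => p a b)
    (hp.comp (Primrec.snd.pair Primrec.fst))) hf Primrec.id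

theorem primrecPred_mem {f : α → β} {g : α → List β} (hf : Primrec f) (hg : Primrec g) :
    PrimrecPred fun x => f x ∈ g x :=
  (primrecPred_exists_mem hg (p := fun x b => b = f x)
    (primrecPred_eq (by fun_prop) (by fun_prop))).of_eq fun x => by simp

theorem primrecPred_subset {f g : α → List β} (hf : Primrec f) (hg : Primrec g) :
    PrimrecPred fun x => f x ⊆ g x :=
  (primrecPred_forall_mem hf (p := fun x b => b ∈ g x)
    (primrecPred_mem (by fun_prop) (by fun_prop))).of_eq fun x => Iff.rfl

end Primitive

/-! ### Closure properties of recursively enumerable predicates -/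

section RE

variable {α β : Type*} [Primcodable α] [Primcodable β]

-- Halting is witnessed by a step bound for `evaln`; conversely, unbounded search finds a witness.
-- The closure properties below become manipulations of the primitive recursive matrix `R`.
open Nat.Partrec in
theorem rePred_iff_exists_primrec {p : α → Prop} :
    REPred p ↔ ∃ R : α → ℕ → Prop, PrimrecPred (fun x : α × ℕ => R x.1 x.2) ∧
      ∀ a, p a ↔ ∃ k, R a k := by
  constructor
  · intro h
    obtain ⟨c, hc⟩ := Code.exists_code.1 h
    refine ⟨fun a k => (Code.evaln k c (Encodable.encode a)).isSome = true, ?_, fun a => ?_⟩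
    · refine primrecPred_eq (Primrec.option_isSome.comp (Code.primrec_evaln.comp
        (f := fun x : (ℕ × Code) × ℕ => Code.evaln x.1.1 x.1.2 x.2)
        (g := fun x : α × ℕ => ((x.2, c), Encodable.encode x.1)) ?_)) (Primrec.const _)
      fun_prop
    · have h1 : p a ↔ (Code.eval c (Encodable.encode a)).Dom := by
        rw [hc]
        simp [Part.assert]
      rw [h1, Part.dom_iff_mem]
      simp only [Code.evaln_complete, Option.isSome_iff_exists, Option.mem_def]
      exact exists_comm
  · rintro ⟨R, ⟨hd, hR⟩, h⟩
    have h2 : Partrec fun a => Nat.rfind fun k =>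
        (Part.some (@decide (R a k) (hd (a, k))) : Part Bool) :=
      Partrec.rfind (p := fun a k => (Part.some (@decide (R a k) (hd (a, k))) : Part Bool))
        hR.to_comp.partrec
    refine h2.dom_re.of_eq fun a => ?_
    rw [h a]
    refine Nat.rfind_dom'.trans ?_
    constructor
    · rintro ⟨k, hk, -⟩
      exact ⟨k, by simpa using hk⟩
    · rintro ⟨k, hk⟩
      exact ⟨k, by simpa using hk, fun _ => trivial⟩

theorem _root_.PrimrecPred.rePred {p : α → Prop} (hp : PrimrecPred p) : REPred p :=
  hp.computablePred.to_re

theorem _root_.REPred.comp {p : β → Prop} {f : α → β} (hp : REPred p) (hf : Primrec f) :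
    REPred fun a => p (f a) :=
  Partrec.comp hp hf.to_comp

theorem _root_.REPred.and {p q : α → Prop} (hp : REPred p) (hq : REPred q) :
    REPred fun a => p a ∧ q a := by
  obtain ⟨R, hR, h⟩ := rePred_iff_exists_primrec.1 hp
  obtain ⟨R', hR', h'⟩ := rePred_iff_exists_primrec.1 hq
  refine rePred_iff_exists_primrec.2 ⟨fun a k => R a k.unpair.1 ∧ R' a k.unpair.2, ?_, fun a => ?_⟩
  · exact (hR.comp (f := fun x : α × ℕ => (x.1, x.2.unpair.1)) (by fun_prop)).and
      (hR'.comp (f := fun x : α × ℕ => (x.1, x.2.unpair.2)) (by fun_prop))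
  · rw [h, h']
    constructor
    · rintro ⟨⟨k, hk⟩, l, hl⟩
      exact ⟨Nat.pair k l, by simpa using ⟨hk, hl⟩⟩
    · rintro ⟨k, h1, h2⟩
      exact ⟨⟨_, h1⟩, _, h2⟩

theorem _root_.REPred.or {p q : α → Prop} (hp : REPred p) (hq : REPred q) :
    REPred fun a => p a ∨ q a := by
  obtain ⟨R, hR, h⟩ := rePred_iff_exists_primrec.1 hp
  obtain ⟨R', hR', h'⟩ := rePred_iff_exists_primrec.1 hq
  refine rePred_iff_exists_primrec.2 ⟨fun a k => R a k ∨ R' a k, hR.or hR', fun a => ?_⟩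
  rw [h, h', exists_or]

theorem _root_.REPred.exists {p : α → β → Prop} (hp : REPred fun x : α × β => p x.1 x.2) :
    REPred fun a => ∃ b, p a b := by
  obtain ⟨R, hR, h⟩ := rePred_iff_exists_primrec.1 hp
  refine rePred_iff_exists_primrec.2
    -- One number `k` carries both a code of `b` and the witness for `b`; the list has at most one
    -- member, so the inner quantifier is bounded.
    ⟨fun a k => ∃ b ∈ ((Encodable.decode k.unpair.1 : Option β)).toList, R (a, b) k.unpair.2,
      ?_, fun a => ?_⟩
  · refine primrecPred_exists_mem (Primrec.optionToList.comp ?_)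
      (hR.comp (f := fun x : (α × ℕ) × β => ((x.1.1, x.2), x.1.2.unpair.2)) ?_) <;> fun_prop
  · constructor
    · rintro ⟨b, hb⟩
      obtain ⟨k, hk⟩ := (h (a, b)).1 hb
      exact ⟨Nat.pair (Encodable.encode b) k, b, by simp, by simpa using hk⟩
    · rintro ⟨k, b, -, hk⟩
      exact ⟨b, (h (a, b)).2 ⟨_, hk⟩⟩

/-- Collection: the finitely many witnesses have a common bound `n`, so the unbounded quantifier can
be moved to the front. -/
theorem _root_.REPred.forall_mem {p : α → β → Prop} {l : α → List β}
    (hp : REPred fun x : α × β => p x.1 x.2) (hl : Primrec l) :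
    REPred fun a => ∀ b ∈ l a, p a b := by
  obtain ⟨R, hR, h⟩ := rePred_iff_exists_primrec.1 hp
  refine rePred_iff_exists_primrec.2
    ⟨fun a n => ∀ b ∈ l a, ∃ k ∈ List.range n, R (a, b) k, ?_, fun a => ?_⟩
  · refine primrecPred_forall_mem (by fun_prop) (primrecPred_exists_mem (by fun_prop)
      (hR.comp (f := fun x : ((α × ℕ) × β) × ℕ => ((x.1.1.1, x.1.2), x.2)) (by fun_prop)))
  · constructor
    · intro H
      have H' : ∀ b ∈ l a, ∃ k, R (a, b) k := fun b hb => (h (a, b)).1 (H b hb)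
      change ∃ n, ∀ b ∈ l a, ∃ k ∈ List.range n, R (a, b) k
      clear H
      generalize l a = L at H' ⊢
      induction L with
      | nil => exact ⟨0, by simp⟩
      | cons b L ih =>
        obtain ⟨n, hn⟩ := ih fun b hb => H' b (List.mem_cons_of_mem _ hb)
        obtain ⟨k, hk⟩ := H' b List.mem_cons_self
        refine ⟨max n (k + 1), fun c hc => ?_⟩
        rcases List.mem_cons.1 hc with rfl | hc
        · exact ⟨k, by simp, hk⟩
        · obtain ⟨j, hj, hR⟩ := hn c hc
          exact ⟨j, by simp at hj ⊢; omega, hR⟩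
    · rintro ⟨n, hn⟩ b hb
      obtain ⟨k, -, hk⟩ := hn b hb
      exact (h (a, b)).2 ⟨k, hk⟩

end RE

/-! ### Inductively generated predicates -/

section Generated

variable {α : Type*}

/-- The least predicate closed under the rules `R`: if `R (l, x)` then `x` follows from the
members of `l`. -/
inductive Generated (R : List α × α → Prop) : α → Prop
  | rule (l : List α) (x : α) : R (l, x) → (∀ y ∈ l, Generated R y) → Generated R x

/-- Derivations from the rules `R`, the last step first. -/
def IsDerivation (R : List α × α → Prop) (d : List (List α × α)) : Prop :=
  (∀ s ∈ d, R s) ∧ ∀ i ∈ List.range d.length, ∀ s ∈ (d.drop i).take 1,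
    s.1 ⊆ (d.drop (i + 1)).map Prod.snd

variable {R : List α × α → Prop}

theorem isDerivation_nil : IsDerivation R [] := ⟨by simp, by simp⟩

/-- `IsDerivation` is phrased with indices so that, apart from `R`, it uses only bounded quantifiers
over lists. This is the recursive form needed for inductions. -/
theorem isDerivation_cons {s : List α × α} {d : List (List α × α)} :
    IsDerivation R (s :: d) ↔ R s ∧ s.1 ⊆ d.map Prod.snd ∧ IsDerivation R d := by
  constructor
  · rintro ⟨h1, h2⟩
    refine ⟨h1 s List.mem_cons_self, ?_, fun t ht => h1 t (List.mem_cons_of_mem _ ht), ?_⟩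
    · simpa using h2 0 (by simp) s (by simp)
    · intro i hi t ht
      exact h2 (i + 1) (by simpa using hi) t ht
  · rintro ⟨h1, h2, h3, h4⟩
    refine ⟨by simpa using ⟨h1, fun a b => h3 (a, b)⟩, fun i hi => ?_⟩
    cases i with
    | zero =>
      intro t ht
      have : t = s := by simpa using ht
      subst this
      simpa using h2
    | succ i => exact h4 i (by simpa using hi)

theorem IsDerivation.append {d e : List (List α × α)} (hd : IsDerivation R d)
    (he : IsDerivation R e) : IsDerivation R (d ++ e) := by
  induction d with
  | nil => exact he
  | cons s d ih =>
    obtain ⟨h1, h2, h3⟩ := isDerivation_cons.1 hd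
    refine isDerivation_cons.2 ⟨h1, fun x hx => ?_, ih h3⟩
    change x ∈ (d ++ e).map Prod.snd
    rw [List.map_append]
    exact List.mem_append_left _ (h2 hx)

theorem IsDerivation.generated {d : List (List α × α)} (hd : IsDerivation R d) :
    ∀ x ∈ d.map Prod.snd, Generated R x := by
  induction d with
  | nil => simp
  | cons s d ih =>
    obtain ⟨h1, h2, h3⟩ := isDerivation_cons.1 hd
    intro x hx
    rcases List.mem_cons.1 hx with rfl | hx
    · exact Generated.rule s.1 s.2 h1 fun y hy => ih h3 y (h2 hy)
    · exact ih h3 x hx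

/-- Derivations of the premises are concatenated and the new step is put in front. -/
theorem Generated.exists_isDerivation {x : α} (h : Generated R x) :
    ∃ d, IsDerivation R d ∧ x ∈ d.map Prod.snd := by
  induction h with
  | rule l x hR _ ih =>
    have : ∃ d, IsDerivation R d ∧ l ⊆ d.map Prod.snd := by
      clear hR
      induction l with
      | nil => exact ⟨[], isDerivation_nil, by simp⟩
      | cons a l ihl =>
        obtain ⟨d, hd, hl⟩ := ihl (fun y hy => by grind) fun y hy => ih y (by grind)
        obtain ⟨e, he, ha⟩ := ih a (by grind)
        refine ⟨e ++ d, he.append hd, fun y hy => ?_⟩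
        rw [List.map_append]
        rcases List.mem_cons.1 hy with rfl | hy
        · exact List.mem_append_left _ ha
        · exact List.mem_append_right _ (hl hy)
    obtain ⟨d, hd, hl⟩ := this
    exact ⟨(l, x) :: d, isDerivation_cons.2 ⟨hR, hl, hd⟩, by simp⟩

theorem generated_iff {x : α} :
    Generated R x ↔ ∃ d, IsDerivation R d ∧ x ∈ d.map Prod.snd :=
  ⟨Generated.exists_isDerivation, fun ⟨_, hd, hx⟩ => hd.generated x hx⟩

/-- Search for a derivation: its steps can be confirmed through `R`, and its shape is primitive
recursive. -/
theorem rePred_generated [Primcodable α] (hR : REPred R) : REPred (Generated R) := by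
  refine REPred.of_eq (REPred.exists (REPred.and (REPred.and ?_ ?_) ?_))
    fun x => generated_iff.symm
  · exact REPred.forall_mem (hR.comp (f := fun x : (α × List (List α × α)) × (List α × α) => x.2)
      (by fun_prop)) (by fun_prop)
  · refine PrimrecPred.rePred (primrecPred_forall_mem (by fun_prop)
      (primrecPred_forall_mem (by fun_prop) ?_))
    exact primrecPred_subset
      (f := fun x : ((α × List (List α × α)) × ℕ) × (List α × α) => x.2.1)
      (g := fun x => (x.1.1.2.drop (x.1.2 + 1)).map Prod.snd) (by fun_prop) (by fun_prop)
  · exact PrimrecPred.rePred (primrecPred_mem (by fun_prop) (by fun_prop))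

end Generated

attribute [fun_prop] PrimrecPred
attribute [fun_prop] primrecPred_eq primrecPred_lt primrecPred_mem primrecPred_subset

@[fun_prop] theorem primrecPred_or {α : Type*} [Primcodable α] {p q : α → Prop}
    (hp : PrimrecPred p) (hq : PrimrecPred q) : PrimrecPred fun x => p x ∨ q x := hp.or hq

@[fun_prop] theorem primrecPred_and {α : Type*} [Primcodable α] {p q : α → Prop}
    (hp : PrimrecPred p) (hq : PrimrecPred q) : PrimrecPred fun x => p x ∧ q x := hp.and hq

/-! ### Polish notation -/

/-- The tokens of Polish notation. -/
abbrev Token := ℕ × ℕ × ℕ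

/-- The number of expressions that follow a token. -/
def Token.arity (c : Token) : ℕ :=
  if c.1 = 1 ∨ c.1 = 4 then c.2.1 else if c.1 = 3 ∨ c.1 = 5 then 2 else if c.1 = 6 then 1 else 0

/-- The suffixes of a string that remain after its first `0, 1, 2, ...` expressions. -/
def suffixes (s : List Token) : List (List Token) :=
  s.foldr (fun c g => (c :: g.headI) :: g.drop c.arity) [([] : List Token)]

/-- The suffix of a string after its first expression. -/
def skip (s : List Token) : List Token := (suffixes s).getD 1 []

@[fun_prop] theorem primrec_arity {α : Type*} [Primcodable α] {f : α → Token} (hf : Primrec f) :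
    Primrec fun x => (f x).arity := by
  unfold Token.arity
  fun_prop

@[fun_prop] theorem primrec_skip {α : Type*} [Primcodable α] {f : α → List Token}
    (hf : Primrec f) : Primrec fun x => skip (f x) := by
  unfold skip suffixes
  fun_prop

/-- The fold in `suffixes` cannot see the tail it has processed; it recovers it as the head of the
accumulated list. -/
theorem suffixes_headI (s : List Token) : (suffixes s).headI = s := by
  induction s with
  | nil => rfl
  | cons c s ih =>
    change c :: (suffixes s).headI = c :: s
    rw [ih]

/-- The expression starting with `c` ends where its `c.arity` arguments end, so the suffixes after
fewer arguments are discarded. -/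
theorem suffixes_cons (c : Token) (s : List Token) :
    suffixes (c :: s) = (c :: s) :: (suffixes s).drop c.arity := by
  change (c :: (suffixes s).headI) :: _ = _
  rw [suffixes_headI]
  rfl

theorem length_le_of_mem_suffixes {s t : List Token} (h : t ∈ suffixes s) :
    t.length ≤ s.length := by
  induction s generalizing t with
  | nil =>
    have : t = [] := by simpa [suffixes] using h
    simp [this]
  | cons c s ih =>
    rw [suffixes_cons] at h
    rcases List.mem_cons.1 h with rfl | h
    · exact le_rfl
    · exact (ih (List.mem_of_mem_drop h)).trans (by simp)

/-- Needed for the termination of `StringTruth` at implications. -/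
theorem length_skip_le (s : List Token) : (skip s).length ≤ s.length := by
  unfold skip
  by_cases h : 1 < (suffixes s).length
  · rw [List.getD_eq_getElem _ _ h]
    exact length_le_of_mem_suffixes (List.getElem_mem h)
  · rw [List.getD_eq_default _ _ (not_lt.1 h)]
    simp

theorem suffixes_flatten {L : List (List Token)}
    (hL : ∀ s ∈ L, ∀ r, suffixes (s ++ r) = (s ++ r) :: suffixes r) (r : List Token) :
    (suffixes (L.flatten ++ r)).drop L.length = suffixes r := by
  induction L with
  | nil => rfl
  | cons s L ih =>
    rw [List.flatten_cons, List.append_assoc, hL s List.mem_cons_self]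
    exact ih fun t ht => hL t (List.mem_cons_of_mem _ ht)

/-- Unique readability: a term counts as exactly one expression, whatever follows it, since its
leading token discards one entry for each argument. -/
theorem suffixes_termTokens {n : ℕ} (t : (qLang S).Term (Empty ⊕ Fin n)) (r : List Token) :
    suffixes (termTokens t ++ r) = (termTokens t ++ r) :: suffixes r := by
  induction t generalizing r with
  | var i =>
    rcases i with e | i
    · exact e.elim
    · simp [termTokens, suffixes_cons, Token.arity]
  | @func k f ts ih =>
    rw [termTokens, List.cons_append, suffixes_cons]
    have := suffixes_flatten (L := List.ofFn fun i => termTokens (ts i))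
      (fun s hs r => by
        obtain ⟨i, rfl⟩ := (List.mem_ofFn' _ _).1 hs
        exact ih i r) r
    rw [List.length_ofFn] at this
    simp [Token.arity, this]

theorem suffixes_formulaTokens {n : ℕ} (φ : (qLang S).BoundedFormula Empty n) (r : List Token) :
    suffixes (formulaTokens φ ++ r) = (formulaTokens φ ++ r) :: suffixes r := by
  induction φ generalizing r with
  | falsum => simp [formulaTokens, suffixes_cons, Token.arity]
  | equal t u =>
    simp [formulaTokens, suffixes_cons, Token.arity, suffixes_termTokens]
  | @rel n k R ts =>
    rw [formulaTokens, List.cons_append, suffixes_cons]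
    have := suffixes_flatten (L := List.ofFn fun i => termTokens (ts i))
      (fun s hs r => by
        obtain ⟨i, rfl⟩ := (List.mem_ofFn' _ _).1 hs
        exact suffixes_termTokens _ r) r
    rw [List.length_ofFn] at this
    simp [Token.arity, this]
  | imp φ ψ ih1 ih2 => simp [formulaTokens, suffixes_cons, Token.arity, ih1, ih2]
  | all φ ih => simp [formulaTokens, suffixes_cons, Token.arity, ih]

theorem skip_formulaTokens {n : ℕ} (φ : (qLang S).BoundedFormula Empty n) (r : List Token) :
    skip (formulaTokens φ ++ r) = r := by
  rw [skip, suffixes_formulaTokens]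
  have := suffixes_headI r
  cases h : suffixes r with
  | nil =>
    rw [h] at this
    exact this
  | cons a l =>
    rw [h] at this
    exact this

/-! ### Evaluation and truth of strings in Polish notation -/

section Eval

variable {X Y : Type*}

/-- One step of the evaluation of a string of terms from right to left. -/
def evalStep (F : ℕ → List X → X) (x : X) (a : List X) (c : Token) (st : List X) : List X :=
  if c.1 = 0 then a.getD c.2.2 x :: st else F c.2.2 (st.take c.2.1) :: st.drop c.2.1

/-- The values of the terms of a string under the assignment `a`, where the function symbol number
`f` has the interpretation `F f` and `x` is a default value. -/
def evalStack (F : ℕ → List X → X) (x : X) (a : List X) (s : List Token) : List X :=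
  s.foldr (evalStep F x a) []

theorem evalStack_cons (F : ℕ → List X → X) (x : X) (a : List X) (c : Token) (s : List Token) :
    evalStack F x a (c :: s) = evalStep F x a c (evalStack F x a s) := rfl

theorem map_evalStack {F : ℕ → List X → X} {G : ℕ → List Y → Y} {h : X → Y}
    (hF : ∀ f l, h (F f l) = G f (l.map h)) (x : X) (a : List X) (s : List Token) :
    (evalStack F x a s).map h = evalStack G (h x) (a.map h) s := by
  induction s with
  | nil => rfl
  | cons c s ih =>
    rw [evalStack_cons, evalStack_cons, ← ih, evalStep, evalStep]
    split_ifs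
    · simp
    · simp [hF]

theorem evalStack_flatten {F : ℕ → List X → X} {x : X} {a : List X} {k : ℕ}
    {T : Fin k → List Token} {y : Fin k → X}
    (h : ∀ i r, evalStack F x a (T i ++ r) = y i :: evalStack F x a r) (r : List Token) :
    evalStack F x a ((List.ofFn T).flatten ++ r) = List.ofFn y ++ evalStack F x a r := by
  induction k with
  | zero => simp
  | succ k ih =>
    rw [List.ofFn_succ, List.flatten_cons, List.append_assoc, h, ih (fun i => h i.succ),
      List.ofFn_succ, List.cons_append]

variable {M : Type*} [(qLang S).Structure M]

/-- Evaluating a term pushes one value onto the stack. The value `y` precedes the quantifier over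
`r` because it must not depend on what follows the term. -/
theorem exists_evalStack_termTokens {F : ℕ → List X → X} {h : X → M}
    (hF : ∀ (k : ℕ) (f : (qLang S).Functions k) (xs : Fin k → X),
      h (F f.1 (List.ofFn xs)) = Language.Structure.funMap f (h ∘ xs))
    (x : X) {n : ℕ} (a : Fin n → X) (t : (qLang S).Term (Empty ⊕ Fin n)) :
    ∃ y, h y = t.realize (Sum.elim (default : Empty → M) (h ∘ a)) ∧
      ∀ r, evalStack F x (List.ofFn a) (termTokens t ++ r) =
        y :: evalStack F x (List.ofFn a) r := by
  induction t with
  | var i =>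
    rcases i with e | i
    · exact e.elim
    · refine ⟨a i, rfl, fun r => ?_⟩
      simp [termTokens, evalStack_cons, evalStep]
  | @func k f ts ih =>
    choose y hy hr using ih
    refine ⟨F f.1 (List.ofFn y), ?_, fun r => ?_⟩
    · rw [hF, Language.Term.realize]
      congr 1
      exact funext hy
    · rw [termTokens, List.cons_append, evalStack_cons, evalStack_flatten hr]
      simp [evalStep]

/-- A truth predicate on strings that behaves at each token as the structure demands agrees with
the structure on formulas. -/
theorem truth_iff_realize {F : ℕ → List X → X} {h : X → M} (hs : Function.Surjective h)
    (hF : ∀ (k : ℕ) (f : (qLang S).Functions k) (xs : Fin k → X),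
      h (F f.1 (List.ofFn xs)) = Language.Structure.funMap f (h ∘ xs))
    (x : X) {V : List Token → List X → Prop}
    (hbot : ∀ s a, ¬ V ((2, 0, 0) :: s) a)
    (himp : ∀ s a, V ((5, 0, 0) :: s) a ↔ (V s a → V (skip s) a))
    (heq : ∀ s a, V ((3, 0, 0) :: s) a ↔
      h ((evalStack F x a s).getD 0 x) = h ((evalStack F x a s).getD 1 x))
    (hrel : ∀ s a (k : ℕ) (R : (qLang S).Relations k) (xs : Fin k → X),
      (evalStack F x a s).take k = List.ofFn xs →
        (V ((4, k, R.1) :: s) a ↔ Language.Structure.RelMap R (h ∘ xs)))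
    (hall : ∀ s a, V ((6, 0, 0) :: s) a ↔ ∀ y, V s (a ++ [y]))
    {n : ℕ} (φ : (qLang S).BoundedFormula Empty n) (a : Fin n → X) (r : List Token) :
    V (formulaTokens φ ++ r) (List.ofFn a) ↔ φ.Realize default (h ∘ a) := by
  induction φ generalizing r with
  | falsum => simpa [formulaTokens, Language.BoundedFormula.Realize] using hbot _ _
  | equal t u =>
    obtain ⟨y, hy, ht⟩ := exists_evalStack_termTokens hF x a t
    obtain ⟨z, hz, hu⟩ := exists_evalStack_termTokens hF x a u
    simp [formulaTokens, heq, ht, hu, hy, hz, Language.BoundedFormula.Realize]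
  | @rel n k R ts =>
    choose y hy hr using fun i => exists_evalStack_termTokens hF x a (ts i)
    rw [formulaTokens, List.cons_append, hrel _ _ k R y]
    · rw [Language.BoundedFormula.Realize, show h ∘ y = _ from funext hy]
    · rw [evalStack_flatten hr]
      simp
  | imp φ ψ ih1 ih2 =>
    rw [formulaTokens, List.cons_append, himp, List.append_assoc, skip_formulaTokens, ih1, ih2]
    rfl
  | @all n φ ih =>
    rw [formulaTokens, List.cons_append, hall, Language.BoundedFormula.Realize, hs.forall]
    refine forall_congr' fun y => ?_
    -- The newly bound variable has index `n`, so its value is appended at the end of the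
    -- assignment.
    rw [← Fin.comp_snoc, ← ih _ r, List.ofFn_succ', List.concat_eq_append]
    simp only [Fin.snoc_castSucc, Fin.snoc_last]

end Eval

/-! ### Propositional refutations -/

/-- A clause: a disjunction of literals. -/
abbrev Clause := List (ℕ × Bool)

/-- The valuation `v` makes the literal `p` true. -/
def Agrees (v : ℕ → Bool) (p : ℕ × Bool) : Prop := v p.1 = p.2

/-- The rules of semantic trees: a partial valuation `A` is refuted if it falsifies a clause in
`𝒞`, or if both its extensions to some variable are refuted. -/
def SplitRule (𝒞 : Clause → Prop) (x : List Clause × Clause) : Prop :=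
  (x.1 = [] ∧ ∃ C, 𝒞 C ∧ C.map (fun p => (p.1, !p.2)) ⊆ x.2) ∨
    ∃ n : ℕ, x.1 = [(n, true) :: x.2, (n, false) :: x.2]

theorem rePred_splitRule {𝒞 : Clause → Prop} (h𝒞 : REPred 𝒞) : REPred (SplitRule 𝒞) := by
  refine REPred.or (REPred.and ?_ (REPred.exists (REPred.and ?_ ?_))) (REPred.exists ?_)
  · exact PrimrecPred.rePred (by fun_prop)
  · exact h𝒞.comp (f := fun x : (List Clause × Clause) × Clause => x.2) (by fun_prop)
  · exact PrimrecPred.rePred (by fun_prop)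
  · exact PrimrecPred.rePred (by fun_prop)

/-- Soundness of semantic trees: at each split, `v` makes one of the two branches true, and at a
leaf it would falsify a clause of `𝒞`. -/
theorem not_generated_splitRule {𝒞 : Clause → Prop} {v : ℕ → Bool}
    (hv : ∀ C, 𝒞 C → ∃ p ∈ C, Agrees v p) {A : Clause} (hA : ∀ p ∈ A, Agrees v p) :
    ¬ Generated (SplitRule 𝒞) A := by
  intro h
  induction h with
  | rule l A hR _ ih =>
    rcases hR with ⟨-, C, hC, hCA⟩ | ⟨n, hl⟩
    · obtain ⟨p, hp, hvp⟩ := hv C hC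
      have := hA _ (hCA (List.mem_map_of_mem hp))
      simp only [Agrees] at this hvp
      rw [hvp] at this
      simp at this
    · change l = [(n, true) :: A, (n, false) :: A] at hl
      subst hl
      refine ih ((n, v n) :: A) ?_ ?_
      · cases v n <;> simp
      · intro p hp
        rcases List.mem_cons.1 hp with rfl | hp
        · rfl
        · exact hA p hp

/-- Completeness of semantic trees: an unrefuted partial valuation stays unrefuted under one of the
two choices for the next variable. Deciding all variables in turn gives `v`; a clause false under
`v` involves finitely many variables and would refute a finite stage. -/
theorem exists_valuation {𝒞 : Clause → Prop} (hem : ∀ n, 𝒞 [(n, true), (n, false)]) {A : Clause}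
    (h : ¬ Generated (SplitRule 𝒞) A) :
    ∃ v : ℕ → Bool, (∀ C, 𝒞 C → ∃ p ∈ C, Agrees v p) ∧ ∀ p ∈ A, Agrees v p := by
  have step : ∀ (n : ℕ) (B : {B : Clause // ¬ Generated (SplitRule 𝒞) B}),
      ∃ b : Bool, ¬ Generated (SplitRule 𝒞) ((n, b) :: B.1) := by
    rintro n ⟨B, hB⟩
    by_contra! H
    refine hB (Generated.rule [(n, true) :: B, (n, false) :: B] _ (Or.inr ⟨n, rfl⟩) fun y hy => ?_)
    simp only [List.mem_cons, List.not_mem_nil, or_false] at hy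
    rcases hy with rfl | rfl <;> exact H _
  choose b hb using step
  let B : ℕ → {B : Clause // ¬ Generated (SplitRule 𝒞) B} := fun n =>
    Nat.rec ⟨A, h⟩ (fun k B => ⟨(k, b k B) :: B.1, hb k B⟩) n
  have hB : ∀ n, (B (n + 1)).1 = (n, b n (B n)) :: (B n).1 := fun n => rfl
  have hmono : ∀ m n, m ≤ n → (B m).1 ⊆ (B n).1 := by
    intro m n hmn
    induction n, hmn using Nat.le_induction with
    | base => exact List.Subset.refl _
    | succ n _ ih =>
      rw [hB]
      exact List.subset_cons_of_subset _ ih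
  have hmem : ∀ m n, m < n → (m, b m (B m)) ∈ (B n).1 := fun m n hmn =>
    hmono (m + 1) n hmn (by rw [hB]; exact List.mem_cons_self)
  refine ⟨fun n => b n (B n), fun C hC => ?_, fun p hp => ?_⟩
  · by_contra! H
    have hlarge : ∃ N, ∀ p ∈ C, p.1 < N := by
      refine ⟨(C.map Prod.fst).sum + 1, fun p hp => Nat.lt_succ_of_le ?_⟩
      exact List.le_sum_of_mem (List.mem_map_of_mem hp)
    obtain ⟨N, hN⟩ := hlarge
    refine (B N).2 (Generated.rule [] _ (Or.inl ⟨rfl, C, hC, fun q hq => ?_⟩) (by simp))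
    obtain ⟨p, hp, rfl⟩ := List.mem_map.1 hq
    have h1 := H p hp
    have h2 := hmem _ N (hN p hp)
    have h3 : b p.1 (B p.1) = !p.2 := by
      simp only [Agrees] at h1
      exact Bool.eq_not.2 h1
    rwa [h3] at h2
  · by_contra H
    have h3 : b p.1 (B p.1) = !p.2 := Bool.eq_not.2 H
    have h2 := hmem p.1 (p.1 + 1) (Nat.lt_succ_self _)
    rw [h3] at h2
    have h1 : (p.1, p.2) ∈ (B (p.1 + 1)).1 := hmono 0 (p.1 + 1) (Nat.zero_le _) hp
    -- If `v` disagrees with a literal of `A`, this stage contains both literals of the variable and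
    -- thus falsifies its excluded middle clause.
    refine (B (p.1 + 1)).2 (Generated.rule [] _ (Or.inl ⟨rfl, _, hem p.1, ?_⟩) (by simp))
    cases hp2 : p.2 <;> simp_all

/-! ### The Herbrand clauses -/

/-- The value of the function symbol number `f` in the Herbrand universe, which consists of the
natural numbers. -/
def herbrandFun (f : ℕ) (l : List ℕ) : ℕ := Encodable.encode ((Sum.inl f : ℕ ⊕ List Token), l)

/-- The element of the Herbrand universe that is a counterexample to the universal closure of the
formula at the beginning of `s` if there is one. -/
def witness (s : List Token) (l : List ℕ) : ℕ :=
  Encodable.encode ((Sum.inr s : ℕ ⊕ List Token), l)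

/-- Propositional variables: the truth of the formula at the beginning of a string under an
assignment, the equality of two elements, and the relation number `R` for a list of elements. -/
abbrev PropVar := (List Token × List ℕ) ⊕ (ℕ × ℕ) ⊕ (ℕ × List ℕ)

/-- The propositional variable for the truth of a string. -/
def truthVar (s : List Token) (a : List ℕ) : ℕ := Encodable.encode (Sum.inl (s, a) : PropVar)

/-- The propositional variable for an equality. -/
def eqVar (x y : ℕ) : ℕ := Encodable.encode (Sum.inr (Sum.inl (x, y)) : PropVar)

/-- The propositional variable for a relation. -/
def relVar (R : ℕ) (l : List ℕ) : ℕ := Encodable.encode (Sum.inr (Sum.inr (R, l)) : PropVar)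

/-- The values of the terms of a string in the Herbrand universe. -/
def herbrandStack (a : List ℕ) (s : List Token) : List ℕ := evalStack herbrandFun 0 a s

/-- The clauses that describe the truth predicate. -/
def truthClauses (s : List Token) (a : List ℕ) (k R : ℕ) : List Clause :=
  [ [(truthVar ((2, 0, 0) :: s) a, false)],
    [(truthVar ((5, 0, 0) :: s) a, true), (truthVar s a, true)],
    [(truthVar ((5, 0, 0) :: s) a, true), (truthVar (skip s) a, false)],
    [(truthVar ((5, 0, 0) :: s) a, false), (truthVar s a, false), (truthVar (skip s) a, true)],
    [(truthVar ((3, 0, 0) :: s) a, true),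
      (eqVar ((herbrandStack a s).getD 0 0) ((herbrandStack a s).getD 1 0), false)],
    [(truthVar ((3, 0, 0) :: s) a, false),
      (eqVar ((herbrandStack a s).getD 0 0) ((herbrandStack a s).getD 1 0), true)],
    [(truthVar ((4, k, R) :: s) a, true), (relVar R ((herbrandStack a s).take k), false)],
    [(truthVar ((4, k, R) :: s) a, false), (relVar R ((herbrandStack a s).take k), true)],
    [(truthVar ((6, 0, 0) :: s) a, false), (truthVar s (a ++ [k]), true)],
    [(truthVar ((6, 0, 0) :: s) a, true), (truthVar s (a ++ [witness s a]), false)] ]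

/-- The clauses that describe equality, together with the law of excluded middle. -/
def equalityClauses (x y z : ℕ) (l : List (ℕ × ℕ)) : List Clause :=
  [ [(x, true), (x, false)],
    [(eqVar x x, true)],
    [(eqVar x y, false), (eqVar y x, true)],
    [(eqVar x y, false), (eqVar y z, false), (eqVar x z, true)],
    (eqVar (herbrandFun x (l.map Prod.fst)) (herbrandFun x (l.map Prod.snd)), true) ::
      l.map fun p => (eqVar p.1 p.2, false),
    (relVar x (l.map Prod.fst), false) :: (relVar x (l.map Prod.snd), true) ::
      l.map fun p => (eqVar p.1 p.2, false)]

/-- The Herbrand clauses. -/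
def IsHerbrandClause (C : Clause) : Prop :=
  (∃ p : (List Token × List ℕ) × ℕ × ℕ, C ∈ truthClauses p.1.1 p.1.2 p.2.1 p.2.2) ∨
    ∃ p : (ℕ × ℕ × ℕ) × List (ℕ × ℕ), C ∈ equalityClauses p.1.1 p.1.2.1 p.1.2.2 p.2

@[fun_prop] theorem primrec_herbrandFun {α : Type*} [Primcodable α] {f : α → ℕ} {l : α → List ℕ}
    (hf : Primrec f) (hl : Primrec l) : Primrec fun x => herbrandFun (f x) (l x) := by
  unfold herbrandFun
  fun_prop

@[fun_prop] theorem primrec_truthVar {α : Type*} [Primcodable α] {s : α → List Token}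
    {a : α → List ℕ} (hs : Primrec s) (ha : Primrec a) :
    Primrec fun x => truthVar (s x) (a x) := by
  unfold truthVar
  fun_prop

@[fun_prop] theorem primrec_eqVar {α : Type*} [Primcodable α] {s t : α → ℕ}
    (hs : Primrec s) (ht : Primrec t) : Primrec fun x => eqVar (s x) (t x) := by
  unfold eqVar
  fun_prop

@[fun_prop] theorem primrec_relVar {α : Type*} [Primcodable α] {s : α → ℕ} {a : α → List ℕ}
    (hs : Primrec s) (ha : Primrec a) : Primrec fun x => relVar (s x) (a x) := by
  unfold relVar
  fun_prop

@[fun_prop] theorem primrec_herbrandStack {α : Type*} [Primcodable α] {a : α → List ℕ}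
    {s : α → List Token} (ha : Primrec a) (hs : Primrec s) :
    Primrec fun x => herbrandStack (a x) (s x) := by
  unfold herbrandStack evalStack evalStep
  fun_prop

theorem rePred_isHerbrandClause : REPred IsHerbrandClause := by
  refine REPred.or (REPred.exists (PrimrecPred.rePred ?_))
    (REPred.exists (PrimrecPred.rePred ?_))
  · unfold truthClauses witness
    fun_prop
  · unfold equalityClauses
    fun_prop

/-- The refutability of a partial valuation relative to the Herbrand clauses. -/
def Refutable : Clause → Prop := Generated (SplitRule IsHerbrandClause)

/-- The Herbrand clauses do not refer to a signature, so one enumerable predicate serves all of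
them. -/
theorem rePred_refutable : REPred Refutable :=
  rePred_generated (rePred_splitRule rePred_isHerbrandClause)

/-! ### The structure given by a valuation -/

/-- The valuation `v` makes all Herbrand clauses true. -/
def IsHerbrandModel (v : ℕ → Bool) : Prop := ∀ C, IsHerbrandClause C → ∃ p ∈ C, Agrees v p

section Herbrand

variable {v : ℕ → Bool}


theorem IsHerbrandModel.truth (hv : IsHerbrandModel v) {s : List Token} {a : List ℕ} {k R : ℕ} {C : Clause}
    (hC : C ∈ truthClauses s a k R) : ∃ p ∈ C, Agrees v p :=
  hv C (Or.inl ⟨((s, a), k, R), hC⟩)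

theorem IsHerbrandModel.equality (hv : IsHerbrandModel v) {x y z : ℕ} {l : List (ℕ × ℕ)} {C : Clause}
    (hC : C ∈ equalityClauses x y z l) : ∃ p ∈ C, Agrees v p :=
  hv C (Or.inr ⟨((x, y, z), l), hC⟩)

theorem IsHerbrandModel.eqVar_refl (hv : IsHerbrandModel v) (x : ℕ) : v (eqVar x x) = true := by
  simpa [Agrees] using hv.equality (x := x) (y := x) (z := x) (l := [])
    (C := [(eqVar x x, true)]) (by simp [equalityClauses])

theorem IsHerbrandModel.eqVar_symm (hv : IsHerbrandModel v) {x y : ℕ} (h : v (eqVar x y) = true) :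
    v (eqVar y x) = true := by
  simpa [Agrees, h] using hv.equality (x := x) (y := y) (z := x) (l := [])
    (C := [(eqVar x y, false), (eqVar y x, true)]) (by simp [equalityClauses])

theorem IsHerbrandModel.eqVar_trans (hv : IsHerbrandModel v) {x y z : ℕ} (h : v (eqVar x y) = true)
    (h' : v (eqVar y z) = true) : v (eqVar x z) = true := by
  simpa [Agrees, h, h'] using hv.equality (x := x) (y := y) (z := z) (l := [])
    (C := [(eqVar x y, false), (eqVar y z, false), (eqVar x z, true)]) (by simp [equalityClauses])

theorem IsHerbrandModel.eqVar_fun (hv : IsHerbrandModel v) (f : ℕ) {l : List (ℕ × ℕ)}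
    (h : ∀ p ∈ l, v (eqVar p.1 p.2) = true) :
    v (eqVar (herbrandFun f (l.map Prod.fst)) (herbrandFun f (l.map Prod.snd))) = true := by
  obtain ⟨p, hp, hvp⟩ := hv.equality (x := f) (y := 0) (z := 0) (l := l)
    (C := (eqVar (herbrandFun f (l.map Prod.fst)) (herbrandFun f (l.map Prod.snd)), true) ::
      l.map fun p => (eqVar p.1 p.2, false)) (by simp [equalityClauses])
  rcases List.mem_cons.1 hp with rfl | hp
  · exact hvp
  · obtain ⟨q, hq, rfl⟩ := List.mem_map.1 hp
    simp [Agrees, h q hq] at hvp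

theorem IsHerbrandModel.relVar_imp (hv : IsHerbrandModel v) (R : ℕ) {l : List (ℕ × ℕ)}
    (h : ∀ p ∈ l, v (eqVar p.1 p.2) = true) (hR : v (relVar R (l.map Prod.fst)) = true) :
    v (relVar R (l.map Prod.snd)) = true := by
  obtain ⟨p, hp, hvp⟩ := hv.equality (x := R) (y := 0) (z := 0) (l := l)
    (C := (relVar R (l.map Prod.fst), false) :: (relVar R (l.map Prod.snd), true) ::
      l.map fun p => (eqVar p.1 p.2, false)) (by simp [equalityClauses])
  rcases List.mem_cons.1 hp with rfl | hp
  · simp [Agrees, hR] at hvp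
  rcases List.mem_cons.1 hp with rfl | hp
  · exact hvp
  · obtain ⟨q, hq, rfl⟩ := List.mem_map.1 hp
    simp [Agrees, h q hq] at hvp

/-- Equality in the Herbrand universe. -/
def IsHerbrandModel.setoid (hv : IsHerbrandModel v) : Setoid ℕ where
  r x y := v (eqVar x y) = true
  iseqv := ⟨hv.eqVar_refl, hv.eqVar_symm, hv.eqVar_trans⟩

/-- The quotient of the Herbrand universe by equality. -/
def IsHerbrandModel.Carrier (hv : IsHerbrandModel v) : Type := Quotient hv.setoid

instance IsHerbrandModel.nonempty (hv : IsHerbrandModel v) : Nonempty hv.Carrier := ⟨Quotient.mk hv.setoid 0⟩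

/-- The class of an element of the Herbrand universe. -/
def IsHerbrandModel.mk (hv : IsHerbrandModel v) (x : ℕ) : hv.Carrier := Quotient.mk hv.setoid x

/-- A representative of an element of the quotient. -/
noncomputable def IsHerbrandModel.out (hv : IsHerbrandModel v) (x : hv.Carrier) : ℕ := Quotient.out x

theorem IsHerbrandModel.mk_eq_mk (hv : IsHerbrandModel v) {x y : ℕ} : hv.mk x = hv.mk y ↔ v (eqVar x y) = true :=
  Quotient.eq (r := hv.setoid)

theorem IsHerbrandModel.mk_out (hv : IsHerbrandModel v) (x : hv.Carrier) : hv.mk (hv.out x) = x := Quotient.out_eq x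

theorem IsHerbrandModel.mk_surjective (hv : IsHerbrandModel v) : Function.Surjective hv.mk := fun x => ⟨_, hv.mk_out x⟩

/-- Symbols are interpreted through chosen representatives; the congruence clauses make the choice
irrelevant, as `mk_herbrandFun` and `relVar_iff` show. -/
noncomputable instance IsHerbrandModel.structure (hv : IsHerbrandModel v) : (qLang S).Structure hv.Carrier where
  funMap f xs := hv.mk (herbrandFun f.1 (List.ofFn (hv.out ∘ xs)))
  RelMap R xs := v (relVar R.1 (List.ofFn (hv.out ∘ xs))) = true

theorem IsHerbrandModel.eqVar_pairs (hv : IsHerbrandModel v) {k : ℕ} (xs : Fin k → ℕ) :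
    ∀ p ∈ List.ofFn fun i => (xs i, hv.out (hv.mk (xs i))), v (eqVar p.1 p.2) = true := by
  intro p hp
  obtain ⟨i, rfl⟩ := (List.mem_ofFn' _ _).1 hp
  rw [← hv.mk_eq_mk, hv.mk_out]

theorem IsHerbrandModel.mk_herbrandFun (hv : IsHerbrandModel v) {k : ℕ} (f : (qLang S).Functions k) (xs : Fin k → ℕ) :
    hv.mk (herbrandFun f.1 (List.ofFn xs)) = Language.Structure.funMap f (hv.mk ∘ xs) := by
  have := hv.eqVar_fun f.1 (hv.eqVar_pairs xs)
  rw [List.map_ofFn, List.map_ofFn] at this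
  exact hv.mk_eq_mk.2 this

theorem IsHerbrandModel.relVar_iff (hv : IsHerbrandModel v) {k : ℕ} (R : (qLang S).Relations k) (xs : Fin k → ℕ) :
    v (relVar R.1 (List.ofFn xs)) = true ↔ Language.Structure.RelMap R (hv.mk ∘ xs) := by
  constructor
  · intro h
    have := hv.relVar_imp R.1 (hv.eqVar_pairs xs) (by rwa [List.map_ofFn])
    rwa [List.map_ofFn] at this
  · intro h
    have := hv.relVar_imp R.1 (l := List.ofFn fun i => (hv.out (hv.mk (xs i)), xs i)) ?_ ?_
    · rwa [List.map_ofFn] at this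
    · intro p hp
      obtain ⟨i, rfl⟩ := (List.mem_ofFn' _ _).1 hp
      rw [← hv.mk_eq_mk, hv.mk_out]
    · rw [List.map_ofFn]
      exact h

/-- The clauses in `truthClauses` are Tarski's truth conditions, so `truth_iff_realize` applies to
the predicate read off from `v`. -/
theorem IsHerbrandModel.truthVar_iff_models (hv : IsHerbrandModel v) (φ : Query S) :
    v (truthVar (formulaTokens φ) []) = true ↔ hv.Carrier ⊨ φ := by
  have key := truth_iff_realize (S := S) hv.mk_surjective (fun _ => hv.mk_herbrandFun) 0
    (V := fun s a => v (truthVar s a) = true) ?_ ?_ ?_ ?_ ?_ φ default []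
  · rw [List.append_nil] at key
    rw [Language.Sentence.Realize, Language.Formula.Realize,
      Subsingleton.elim (default : Fin 0 → hv.Carrier) (hv.mk ∘ default)]
    exact key
  · intro s a
    have := hv.truth (s := s) (a := a) (k := 0) (R := 0)
      (C := [(truthVar ((2, 0, 0) :: s) a, false)]) (by simp [truthClauses])
    simpa [Agrees] using this
  · intro s a
    have h1 := hv.truth (s := s) (a := a) (k := 0) (R := 0)
      (C := [(truthVar ((5, 0, 0) :: s) a, true), (truthVar s a, true)]) (by simp [truthClauses])
    have h2 := hv.truth (s := s) (a := a) (k := 0) (R := 0)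
      (C := [(truthVar ((5, 0, 0) :: s) a, true), (truthVar (skip s) a, false)])
      (by simp [truthClauses])
    have h3 := hv.truth (s := s) (a := a) (k := 0) (R := 0)
      (C := [(truthVar ((5, 0, 0) :: s) a, false), (truthVar s a, false),
        (truthVar (skip s) a, true)]) (by simp [truthClauses])
    simp only [Agrees, List.mem_cons, List.not_mem_nil, or_false, exists_eq_or_imp,
      exists_eq_left] at h1 h2 h3
    grind
  · intro s a
    have h1 := hv.truth (s := s) (a := a) (k := 0) (R := 0)
      (C := [(truthVar ((3, 0, 0) :: s) a, true),
        (eqVar ((herbrandStack a s).getD 0 0) ((herbrandStack a s).getD 1 0), false)])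
      (by simp [truthClauses])
    have h2 := hv.truth (s := s) (a := a) (k := 0) (R := 0)
      (C := [(truthVar ((3, 0, 0) :: s) a, false),
        (eqVar ((herbrandStack a s).getD 0 0) ((herbrandStack a s).getD 1 0), true)])
      (by simp [truthClauses])
    simp only [Agrees, List.mem_cons, List.not_mem_nil, or_false, exists_eq_or_imp,
      exists_eq_left] at h1 h2
    rw [hv.mk_eq_mk]
    unfold herbrandStack at h1 h2
    grind
  · intro s a k R xs hxs
    have h1 := hv.truth (s := s) (a := a) (k := k) (R := R.1)
      (C := [(truthVar ((4, k, R.1) :: s) a, true), (relVar R.1 ((herbrandStack a s).take k), false)])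
      (by simp [truthClauses])
    have h2 := hv.truth (s := s) (a := a) (k := k) (R := R.1)
      (C := [(truthVar ((4, k, R.1) :: s) a, false), (relVar R.1 ((herbrandStack a s).take k), true)])
      (by simp [truthClauses])
    simp only [Agrees, List.mem_cons, List.not_mem_nil, or_false, exists_eq_or_imp,
      exists_eq_left] at h1 h2
    rw [← hv.relVar_iff, ← hxs]
    unfold herbrandStack at h1 h2
    grind
  · intro s a
    constructor
    · intro h y
      -- The parameter `k`, an arity in the clauses for relations, is here the element at which the
      -- quantifier is instantiated.
      have h1 := hv.truth (s := s) (a := a) (k := y) (R := 0)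
        (C := [(truthVar ((6, 0, 0) :: s) a, false), (truthVar s (a ++ [y]), true)])
        (by simp [truthClauses])
      simpa [Agrees, h] using h1
    · intro h
      -- Conversely, truth at the single element `witness s a` already yields the universal
      -- statement.
      have h1 := hv.truth (s := s) (a := a) (k := 0) (R := 0)
        (C := [(truthVar ((6, 0, 0) :: s) a, true), (truthVar s (a ++ [witness s a]), false)])
        (by simp [truthClauses])
      simpa [Agrees, h (witness s a)] using h1

end Herbrand

/-! ### The valuation given by a structure -/

section FromStructure

variable {M : Type*}

/-- Truth of the formula at the beginning of a string, for given interpretations of the function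
symbols and the relation symbols by their numbers. -/
def StringTruth (F : ℕ → List M → M) (P : ℕ → List M → Prop) (x : M) :
    List Token → List M → Prop
  | [], _ => False
  | c :: s, a =>
    if c.1 = 3 then (evalStack F x a s).getD 0 x = (evalStack F x a s).getD 1 x
    else if c.1 = 4 then P c.2.2 ((evalStack F x a s).take c.2.1)
    else if c.1 = 5 then StringTruth F P x s a → StringTruth F P x (skip s) a
    else if c.1 = 6 then ∀ y, StringTruth F P x s (a ++ [y])
    else False
termination_by s => s.length
decreasing_by all_goals simp [length_skip_le]

/-- Makes the recursion of `herbrandEval` on codes of argument lists well-founded. -/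
theorem lt_encode_of_mem {l : List ℕ} {x : ℕ} (h : x ∈ l) : x < Encodable.encode l := by
  induction l with
  | nil => simp at h
  | cons y l ih =>
    rw [Encodable.encode_list_cons, Nat.lt_succ_iff]
    rcases List.mem_cons.1 h with rfl | h
    · exact Nat.left_le_pair _ _
    · exact (ih h).le.trans (Nat.right_le_pair _ _)

/-- The evaluation of the elements of the Herbrand universe in a structure. -/
def herbrandEval (G : ℕ ⊕ List Token → List M → M) (x : M) (n : ℕ) : M :=
  match _hn : Encodable.decode₂ ((ℕ ⊕ List Token) × List ℕ) n with
  | none => x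
  | some p => G p.1 (p.2.attach.map fun y => herbrandEval G x y.1)
termination_by n
decreasing_by
  -- Unlike `decode`, `decode₂` succeeds on genuine codes only, so `n` is the code of `p` and
  -- exceeds every argument.
  have h1 := Encodable.mem_decode₂.1 (Option.mem_def.2 _hn)
  rw [← h1, Encodable.encode_prod_val]
  exact (lt_encode_of_mem y.2).trans_le (Nat.right_le_pair _ _)

theorem herbrandEval_encode (G : ℕ ⊕ List Token → List M → M) (x : M)
    (p : (ℕ ⊕ List Token) × List ℕ) :
    herbrandEval G x (Encodable.encode p) = G p.1 (p.2.map (herbrandEval G x)) := by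
  rw [herbrandEval]
  split
  · next h => simp at h
  · next q h =>
    rw [Encodable.encodek₂] at h
    cases h
    congr 1
    exact List.attach_map_val (l := p.2) (f := herbrandEval G x) ▸ rfl

open Classical in
/-- The valuation of the propositional variables for given interpretations of the symbols and a
given mapping of the Herbrand universe. -/
noncomputable def inducedValuation (F : ℕ → List M → M) (P : ℕ → List M → Prop) (h : ℕ → M)
    (n : ℕ) : Bool :=
  decide (∃ p : PropVar, Encodable.encode p = n ∧
    Sum.elim (fun q => StringTruth F P (h 0) q.1 (q.2.map h))
      (Sum.elim (fun q => h q.1 = h q.2) (fun q => P q.1 (q.2.map h))) p)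

section

variable (F : ℕ → List M → M) (P : ℕ → List M → Prop) (h : ℕ → M)

open Classical in
theorem inducedValuation_truthVar (s : List Token) (a : List ℕ) :
    inducedValuation F P h (truthVar s a) = true ↔ StringTruth F P (h 0) s (a.map h) := by
  rw [inducedValuation, truthVar, decide_eq_true_iff]
  constructor
  · rintro ⟨p, hp, H⟩
    rw [Encodable.encode_injective hp] at H
    exact H
  · exact fun H => ⟨_, rfl, H⟩

open Classical in
theorem inducedValuation_eqVar (x y : ℕ) :
    inducedValuation F P h (eqVar x y) = true ↔ h x = h y := by
  rw [inducedValuation, eqVar, decide_eq_true_iff]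
  constructor
  · rintro ⟨p, hp, H⟩
    rw [Encodable.encode_injective hp] at H
    exact H
  · exact fun H => ⟨_, rfl, H⟩

open Classical in
theorem inducedValuation_relVar (R : ℕ) (l : List ℕ) :
    inducedValuation F P h (relVar R l) = true ↔ P R (l.map h) := by
  rw [inducedValuation, relVar, decide_eq_true_iff]
  constructor
  · rintro ⟨p, hp, H⟩
    rw [Encodable.encode_injective hp] at H
    exact H
  · exact fun H => ⟨_, rfl, H⟩

end

/-- `StringTruth` obeys the truth conditions on all strings, even malformed ones, and by `hF` the
map `h` commutes with evaluation. The hypothesis `hw` says that witnesses are Skolem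
counterexamples. -/
theorem isHerbrandModel_inducedValuation {F : ℕ → List M → M} {P : ℕ → List M → Prop} {h : ℕ → M}
    (hF : ∀ f l, h (herbrandFun f l) = F f (l.map h))
    (hw : ∀ s l, StringTruth F P (h 0) s (l.map h ++ [h (witness s l)]) →
      ∀ y, StringTruth F P (h 0) s (l.map h ++ [y])) :
    IsHerbrandModel (inducedValuation F P h) := by
  have hfalse : ∀ {n : ℕ}, (inducedValuation F P h n = false) ↔
      ¬ inducedValuation F P h n = true := by simp
  have hstack : ∀ a s, (herbrandStack a s).map h = evalStack F (h 0) (a.map h) s :=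
    fun a s => map_evalStack hF 0 a s
  have hmap : ∀ l : List (ℕ × ℕ), (∀ p ∈ l, h p.1 = h p.2) →
      (l.map Prod.fst).map h = (l.map Prod.snd).map h := fun l hl => by
    simpa using hl
  have hget : ∀ l i, h ((l : List ℕ).getD i 0) = (l.map h).getD i (h 0) := fun l i => by
    simp
  have hT : ∀ c s a, StringTruth F P (h 0) (c :: s) a ↔
      if c.1 = 3 then (evalStack F (h 0) a s).getD 0 (h 0) = (evalStack F (h 0) a s).getD 1 (h 0)
      else if c.1 = 4 then P c.2.2 ((evalStack F (h 0) a s).take c.2.1)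
      else if c.1 = 5 then StringTruth F P (h 0) s a → StringTruth F P (h 0) (skip s) a
      else if c.1 = 6 then ∀ y, StringTruth F P (h 0) s (a ++ [y])
      else False := fun c s a => by rw [StringTruth]
  rintro C (⟨⟨⟨s, a⟩, k, R⟩, hC⟩ | ⟨⟨⟨x, y, z⟩, l⟩, hC⟩)
  · simp only [truthClauses, List.mem_cons, List.not_mem_nil, or_false] at hC
    rcases hC with rfl | rfl | rfl | rfl | rfl | rfl | rfl | rfl | rfl | rfl <;>
    simp only [Agrees, List.mem_cons, List.not_mem_nil, or_false, exists_eq_or_imp,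
      exists_eq_left, hfalse, inducedValuation_truthVar, inducedValuation_eqVar,
      inducedValuation_relVar, hT, hget, hstack, List.map_take, List.map_append, List.map_cons,
      List.map_nil] <;> norm_num
    all_goals try tauto
    -- What is left is the instantiation clause of the universal quantifier.
    · by_cases H : ∀ y, StringTruth F P (h 0) s (a.map h ++ [y])
      · exact Or.inr (H _)
      · left
        push Not at H
        exact H
  · simp only [equalityClauses, List.mem_cons, List.not_mem_nil, or_false] at hC
    rcases hC with rfl | rfl | rfl | rfl | rfl | rfl
    · simp [Agrees]
    · simp [Agrees, inducedValuation_eqVar]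
    · simp only [Agrees, List.mem_cons, List.not_mem_nil, or_false, exists_eq_or_imp,
        exists_eq_left, hfalse, inducedValuation_eqVar]
      grind
    · simp only [Agrees, List.mem_cons, List.not_mem_nil, or_false, exists_eq_or_imp,
        exists_eq_left, hfalse, inducedValuation_eqVar]
      grind
    · by_cases H : ∀ p ∈ l, h p.1 = h p.2
      · refine ⟨_, List.mem_cons_self, ?_⟩
        rw [Agrees, inducedValuation_eqVar, hF, hF, hmap l H]
      · push Not at H
        obtain ⟨p, hp, hne⟩ := H
        refine ⟨(eqVar p.1 p.2, false), List.mem_cons_of_mem _ (List.mem_map.2 ⟨p, hp, rfl⟩), ?_⟩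
        rwa [Agrees, hfalse, inducedValuation_eqVar]
    · by_cases H : ∀ p ∈ l, h p.1 = h p.2
      · by_cases HP : P x ((l.map Prod.snd).map h)
        · refine ⟨(relVar x (l.map Prod.snd), true), by simp, ?_⟩
          rwa [Agrees, inducedValuation_relVar]
        · refine ⟨(relVar x (l.map Prod.fst), false), by simp, ?_⟩
          rwa [Agrees, hfalse, inducedValuation_relVar, hmap l H]
      · push Not at H
        obtain ⟨p, hp, hne⟩ := H
        refine ⟨(eqVar p.1 p.2, false), List.mem_cons_of_mem _ (List.mem_cons_of_mem _
          (List.mem_map.2 ⟨p, hp, rfl⟩)), ?_⟩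
        rwa [Agrees, hfalse, inducedValuation_eqVar]

variable [(qLang S).Structure M]

open Classical in
/-- The interpretations of the function symbols by their numbers. -/
noncomputable def funOfStructure (S : Signatures) {M : Type*} [(qLang S).Structure M] (x : M)
    (f : ℕ) (l : List M) : M :=
  if h : l.length = 0 ∨ (l.length, f) ∈ S.qFuncs then
    Language.Structure.funMap (L := qLang S) (n := l.length) ⟨f, h⟩ l.get
  else x

/-- The interpretations of the relation symbols by their numbers. -/
def relOfStructure (S : Signatures) {M : Type*} [(qLang S).Structure M] (R : ℕ)
    (l : List M) : Prop :=
  ∃ h : (l.length, R) ∈ S.qPreds,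
    Language.Structure.RelMap (L := qLang S) (n := l.length) ⟨R, h⟩ l.get

/-- Replaces the arity `k` by the length of a list, so that substitution avoids casts between
symbols of equal arities. -/
theorem exists_list_get_eq {k : ℕ} (xs : Fin k → M) :
    ∃ l : List M, ∃ h : l.length = k, xs = l.get ∘ Fin.cast h.symm :=
  ⟨List.ofFn xs, List.length_ofFn, by ext i; simp⟩

theorem funOfStructure_ofFn (x : M) (k : ℕ) (f : (qLang S).Functions k) (xs : Fin k → M) :
    funOfStructure S x f.1 (List.ofFn xs) = Language.Structure.funMap f xs := by
  obtain ⟨l, rfl, rfl⟩ := exists_list_get_eq xs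
  change funOfStructure S x f.1 (List.ofFn l.get) = Language.Structure.funMap f l.get
  rw [List.ofFn_get, funOfStructure, dif_pos f.2]
  rfl

theorem relOfStructure_ofFn {k : ℕ} (R : (qLang S).Relations k) (xs : Fin k → M) :
    relOfStructure S R.1 (List.ofFn xs) ↔ Language.Structure.RelMap R xs := by
  obtain ⟨l, rfl, rfl⟩ := exists_list_get_eq xs
  change relOfStructure S R.1 (List.ofFn l.get) ↔ Language.Structure.RelMap R l.get
  rw [List.ofFn_get, relOfStructure]
  exact ⟨fun ⟨_, h⟩ => h, fun h => ⟨R.2, h⟩⟩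

/-- The truth predicate on strings that belongs to a structure. -/
abbrev TruthIn (S : Signatures) {M : Type*} [(qLang S).Structure M] (x : M) :
    List Token → List M → Prop :=
  StringTruth (funOfStructure S x) (relOfStructure S) x

/-- The case of `truth_iff_realize` in which the structure names its own elements. -/
theorem truthIn_iff_models (x : M) (φ : Query S) :
    TruthIn S x (formulaTokens φ) [] ↔ M ⊨ φ := by
  have key := truth_iff_realize (S := S) (F := funOfStructure S x) (h := (id : M → M))
    Function.surjective_id (funOfStructure_ofFn x) x (V := TruthIn S x) ?_ ?_ ?_ ?_ ?_ φ default []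
  · rw [List.append_nil] at key
    rw [Language.Sentence.Realize, Language.Formula.Realize,
      Subsingleton.elim (default : Fin 0 → M) (id ∘ default)]
    exact key
  all_goals intro s a
  · rw [TruthIn, StringTruth]
    simp
  · rw [TruthIn, StringTruth]
    simp
  · rw [TruthIn, StringTruth]
    simp
  · intro k R xs hxs
    rw [TruthIn, StringTruth, if_neg (by simp), if_pos rfl, hxs]
    exact relOfStructure_ofFn R xs
  · rw [TruthIn, StringTruth]
    simp

/-- Queries with the same string of tokens hold in the same structures. -/
theorem models_congr [Nonempty M] {φ ψ : Query S} (h : formulaTokens φ = formulaTokens ψ) :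
    M ⊨ φ ↔ M ⊨ ψ := by
  obtain ⟨x⟩ := ‹Nonempty M›
  rw [← truthIn_iff_models x, ← truthIn_iff_models x, h]

-- Skolemization: the Herbrand universe is mapped into `M` by interpreting function symbols as in
-- `M` and each `witness` as a chosen counterexample, if one exists.
open Classical in
theorem exists_isHerbrandModel (S : Signatures) (M : Type*) [(qLang S).Structure M] [Nonempty M] :
    ∃ v, IsHerbrandModel v ∧
      ∀ φ : Query S, v (truthVar (formulaTokens φ) []) = true ↔ M ⊨ φ := by
  obtain ⟨m⟩ := ‹Nonempty M›
  -- The number `0`, the default value in `herbrandStack`, is also the code of the constant number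
  -- `0`. The default element of `M` must therefore be the value of that constant; it does not
  -- depend on `m`.
  set x : M := funOfStructure S m 0 [] with hx
  let F := funOfStructure S x
  let P : ℕ → List M → Prop := relOfStructure S
  let G : ℕ ⊕ List Token → List M → M := Sum.elim F fun s l =>
    if H : ∃ y, ¬ StringTruth F P x s (l ++ [y]) then H.choose else x
  let h := herbrandEval G x
  have hF : ∀ f l, h (herbrandFun f l) = F f (l.map h) := fun f l =>
    herbrandEval_encode G x (Sum.inl f, l)
  have h0 : h 0 = x := (hF 0 []).trans (by simp [hx, F, funOfStructure])
  refine ⟨inducedValuation F P h, isHerbrandModel_inducedValuation hF fun s l H => ?_, fun φ => ?_⟩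
  · rw [h0] at H ⊢
    by_contra H'
    push Not at H'
    have hw : h (witness s l) = H'.choose :=
      (herbrandEval_encode G x (Sum.inr s, l)).trans (dif_pos H')
    rw [hw] at H
    exact H'.choose_spec H
  · rw [inducedValuation_truthVar, h0]
    exact truthIn_iff_models x φ

end FromStructure

/-! ### Implication and tautologies -/

/-- An unrefuted tree gives a valuation and hence a structure satisfying `φ` but not `ψ`;
conversely, a countermodel induces a valuation that blocks every refutation. -/
theorem implies_iff_refutable (φ ψ : Query S) :
    Implies φ ψ ↔
      Refutable [(truthVar (formulaTokens φ) [], true), (truthVar (formulaTokens ψ) [], false)] := by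
  rw [Implies, Language.Theory.models_sentence_iff]
  constructor
  · intro h
    by_contra H
    obtain ⟨v, hv, hA⟩ := exists_valuation (fun n => Or.inr ⟨((n, 0, 0), []), List.mem_cons_self⟩) H
    have hv : IsHerbrandModel v := hv
    have h1 := hA _ List.mem_cons_self
    have h2 := hA _ (List.mem_cons_of_mem _ List.mem_cons_self)
    have hφ := (hv.truthVar_iff_models φ).1 h1
    have : hv.Carrier ⊨ ({φ} : (qLang S).Theory) := by simpa using hφ
    have hψ := (hv.truthVar_iff_models ψ).2 (h (Language.Theory.ModelType.of _ hv.Carrier))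
    simp [Agrees, hψ] at h2
  · intro h M
    by_contra H
    obtain ⟨v, hv, hM⟩ := exists_isHerbrandModel S M
    refine not_generated_splitRule hv (fun p hp => ?_) h
    have hφ : M ⊨ φ := M.is_model.realize_of_mem φ rfl
    simp only [List.mem_cons, List.not_mem_nil, or_false] at hp
    rcases hp with rfl | rfl
    · exact (hM φ).2 hφ
    · rw [← hM] at H
      simpa [Agrees] using H

theorem isTautology_iff_refutable (ψ : Query S) :
    IsTautology ψ ↔ Refutable [(truthVar (formulaTokens ψ) [], false)] := by
  rw [IsTautology, Language.Theory.models_sentence_iff]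
  constructor
  · intro h
    by_contra H
    obtain ⟨v, hv, hA⟩ := exists_valuation (fun n => Or.inr ⟨((n, 0, 0), []), List.mem_cons_self⟩) H
    have hv : IsHerbrandModel v := hv
    have h2 := hA _ List.mem_cons_self
    have : hv.Carrier ⊨ (∅ : (qLang S).Theory) := inferInstance
    have hψ := (hv.truthVar_iff_models ψ).2 (h (Language.Theory.ModelType.of _ hv.Carrier))
    simp [Agrees, hψ] at h2
  · intro h M
    by_contra H
    obtain ⟨v, hv, hM⟩ := exists_isHerbrandModel S M
    refine not_generated_splitRule hv (fun p hp => ?_) h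
    simp only [List.mem_cons, List.not_mem_nil, or_false] at hp
    rcases hp with rfl
    rw [← hM] at H
    simpa [Agrees] using H

/-- Substitute for injectivity of the coding: a sentence recovered from its code is known only up to
this equivalence. -/
theorem implies_of_formulaTokens_eq {φ ψ : Query S} (h : formulaTokens φ = formulaTokens ψ) :
    Implies φ ψ := by
  rw [Implies, Language.Theory.models_sentence_iff]
  exact fun M => (models_congr h).1 (M.is_model.realize_of_mem φ rfl)

/-! ### Strings -/

theorem bits_eq {n : ℕ} (hn : n ≠ 0) : Nat.bits n = n.bodd :: Nat.bits n.div2 := by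
  conv_lhs => rw [← Nat.bit_bodd_div2 n]
  refine Nat.bits_append_bit _ _ fun h => ?_
  by_contra hb
  apply hn
  rw [← Nat.bit_bodd_div2 n, h, Bool.eq_false_of_not_eq_true hb]
  rfl

theorem primrec_bits : Primrec Nat.bits := by
  have h : Primrec₂ fun (_ : Unit) (n : ℕ) => Nat.bits n := by
    -- The list `l` holds the values at all smaller numbers, so its length is the current argument.
    refine Primrec.nat_strong_rec _ (g := fun _ l => some (if l.length = 0 then [] else
      l.length.bodd :: l.getD l.length.div2 [])) ?_ fun a n => ?_
    · have h1 : Primrec fun x : Unit × List (List Bool) => x.2.length.bodd :=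
        Primrec.nat_bodd.comp (by fun_prop)
      have h2 : Primrec fun x : Unit × List (List Bool) => x.2.length.div2 :=
        Primrec.nat_div2.comp (by fun_prop)
      refine Primrec.option_some.comp ?_
      fun_prop
    · simp only [List.length_map, List.length_range, Option.some.injEq]
      split_ifs with hn
      · simp [hn]
      · rw [bits_eq hn, List.getD_eq_getElem _ _ (by
          simpa [Nat.div2_val] using Nat.div_lt_self (Nat.pos_of_ne_zero hn) one_lt_two)]
        simp
  exact h.comp (Primrec.const ()) Primrec.id

@[fun_prop] theorem primrec_str {α : Type*} [Primcodable α] {f : α → ℕ} (hf : Primrec f) :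
    Primrec fun x => str (f x) := primrec_bits.comp hf

/-- The number with a given binary representation. -/
def ofStr (w : List Bool) : ℕ := w.foldr (fun b n => if b = true then 2 * n + 1 else 2 * n) 0

@[fun_prop] theorem primrec_ofStr {α : Type*} [Primcodable α] {f : α → List Bool}
    (hf : Primrec f) : Primrec fun x => ofStr (f x) := by
  unfold ofStr
  fun_prop

theorem ofStr_str (n : ℕ) : ofStr (str n) = n := by
  induction n using Nat.strong_induction_on with
  | _ n ih =>
    by_cases hn : n = 0
    · simp [hn, str, ofStr]
    · have h1 : n.div2 < n := by
        simpa [Nat.div2_val] using Nat.div_lt_self (Nat.pos_of_ne_zero hn) one_lt_two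
      have h2 := ih _ h1
      rw [str, bits_eq hn]
      change (if n.bodd = true then 2 * ofStr (str n.div2) + 1 else 2 * ofStr (str n.div2)) = n
      rw [h2]
      have h3 := Nat.bodd_add_div2 n
      cases hb : n.bodd <;> simp [hb] at h3 ⊢ <;> omega

theorem str_injective : Function.Injective str := Function.LeftInverse.injective ofStr_str

/-! ### Renaming of constants by finite lists -/

/-- An injective mapping of the constants that begins with the distinct members of a list. -/
def listRename (t : List ℕ) (c : ℕ) : ℕ := t.getD c (c + t.foldr (· + ·) 0 + 1)

@[fun_prop] theorem primrec_listRename {α : Type*} [Primcodable α] {t : α → List ℕ} {c : α → ℕ}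
    (ht : Primrec t) (hc : Primrec c) : Primrec fun x => listRename (t x) (c x) := by
  unfold listRename
  fun_prop

/-- Listed values are at most the sum of `t`; all other constants are shifted beyond that sum. -/
theorem listRename_injective {t : List ℕ} (ht : t.Nodup) : Function.Injective (listRename t) := by
  have hsum : ∀ c, c < t.length → listRename t c < t.foldr (· + ·) 0 + 1 := fun c hc => by
    rw [listRename, List.getD_eq_getElem _ _ hc, Nat.lt_succ_iff]
    exact List.le_sum_of_mem (List.getElem_mem hc)
  have hlarge : ∀ c, ¬ c < t.length → listRename t c = c + t.foldr (· + ·) 0 + 1 := fun c hc => by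
    rw [listRename, List.getD_eq_default _ _ (not_lt.1 hc)]
  intro c d h
  by_cases hc : c < t.length <;> by_cases hd : d < t.length
  · rw [listRename, listRename, List.getD_eq_getElem _ _ hc, List.getD_eq_getElem _ _ hd] at h
    exact (ht.getElem_inj_iff).1 h
  · have := hsum c hc
    rw [h, hlarge d hd] at this
    omega
  · have := hsum d hd
    rw [← h, hlarge c hc] at this
    omega
  · rw [hlarge c hc, hlarge d hd] at h
    omega

theorem exists_listRename {τ : Const → Const} (hτ : Function.Injective τ) (N : ℕ) :
    ∃ t : List ℕ, t.Nodup ∧ ∀ c < N, listRename t c = τ c := by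
  refine ⟨(List.range N).map τ, (List.nodup_range).map hτ, fun c hc => ?_⟩
  rw [listRename, List.getD_eq_getElem _ _ (by simpa using hc)]
  simp

/-- The images of numbers below `N` are sent back. All other numbers are shifted by `N`, so they
never collide with the former. A full inverse of `τ` need not exist. -/
theorem exists_rename_leftInverse {τ : ℕ → ℕ} (hτ : Function.Injective τ) (N : ℕ) :
    ∃ ρ : ℕ → ℕ, Function.Injective ρ ∧ ∀ c < N, ρ (τ c) = c := by
  classical
  let ρ : ℕ → ℕ := fun x => if h : ∃ c, c < N ∧ τ c = x then h.choose else x + N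
  have h1 : ∀ c, c < N → ρ (τ c) = c := fun c hc => by
    have h : ∃ d, d < N ∧ τ d = τ c := ⟨c, hc, rfl⟩
    exact (dif_pos h).trans (hτ h.choose_spec.2)
  have h2 : ∀ x, (¬ ∃ c, c < N ∧ τ c = x) → ρ x = x + N := fun x hx => dif_neg hx
  refine ⟨ρ, fun x y h => ?_, h1⟩
  by_cases hx : ∃ c, c < N ∧ τ c = x <;> by_cases hy : ∃ c, c < N ∧ τ c = y
  · obtain ⟨c, hc, rfl⟩ := hx
    obtain ⟨d, hd, rfl⟩ := hy
    rw [h1 c hc, h1 d hd] at h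
    rw [h]
  · obtain ⟨c, hc, rfl⟩ := hx
    rw [h1 c hc, h2 y hy] at h
    omega
  · obtain ⟨d, hd, rfl⟩ := hy
    rw [h1 d hd, h2 x hx] at h
    omega
  · rw [h2 x hx, h2 y hy] at h
    omega

/-! ### Codes of queries -/

/-- The string of tokens with a given code. -/
def tokensOf (q : ℕ) : List Token := (Encodable.decode q : Option (List Token)).getD []

@[fun_prop] theorem primrec_tokensOf {α : Type*} [Primcodable α] {f : α → ℕ}
    (hf : Primrec f) : Primrec fun x => tokensOf (f x) := by
  unfold tokensOf
  fun_prop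

theorem tokensOf_queryCode (φ : Query S) : tokensOf (queryCode φ) = formulaTokens φ := by
  rw [tokensOf, queryCode, Encodable.encodek]
  rfl

/-- Renaming of the constants of a token. -/
def renameToken (τ : Const → Const) (c : Token) : Token :=
  if c.1 = 1 ∧ c.2.1 = 0 then (1, 0, τ c.2.2) else c

theorem termTokens_rename (τ : Const → Const) {n : ℕ} (t : (qLang S).Term (Empty ⊕ Fin n)) :
    termTokens ((renameHom S τ).onTerm t) = (termTokens t).map (renameToken τ) := by
  induction t with
  | var i =>
    rcases i with e | i
    · exact e.elim
    · simp [Language.LHom.onTerm, termTokens, renameToken]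
  | @func k f ts ih =>
    rw [Language.LHom.onTerm, termTokens, termTokens, List.map_cons, List.map_flatten,
      List.map_ofFn]
    congr 1
    · by_cases hk : k = 0 <;> simp [renameHom, renameToken, hk]
    · congr 2
      exact funext ih

theorem formulaTokens_onBoundedFormula (τ : Const → Const) {n : ℕ}
    (φ : (qLang S).BoundedFormula Empty n) :
    formulaTokens ((renameHom S τ).onBoundedFormula φ) =
      (formulaTokens φ).map (renameToken τ) := by
  induction φ with
  | falsum => simp [Language.LHom.onBoundedFormula, formulaTokens, renameToken]
  | equal t u =>
    simp [Language.LHom.onBoundedFormula, formulaTokens, renameToken, termTokens_rename,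
      Language.Term.bdEqual]
  | @rel n k R ts =>
    simp only [Language.LHom.onBoundedFormula, Language.Relations.boundedFormula]
    rw [formulaTokens, formulaTokens, List.map_cons, List.map_flatten, List.map_ofFn]
    congr 1
    congr 2
    exact funext fun i => termTokens_rename τ (ts i)
  | imp φ ψ ih1 ih2 =>
    simp [Language.LHom.onBoundedFormula, formulaTokens, renameToken, ih1, ih2]
  | all φ ih => simp [Language.LHom.onBoundedFormula, formulaTokens, renameToken, ih]

theorem formulaTokens_renameQuery (τ : Const → Const) (φ : Query S) :
    formulaTokens (renameQuery τ φ) = (formulaTokens φ).map (renameToken τ) :=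
  formulaTokens_onBoundedFormula τ φ

theorem map_renameToken_congr {τ τ' : Const → Const} {s : List Token}
    (h : ∀ c ∈ s, τ c.2.2 = τ' c.2.2) : s.map (renameToken τ) = s.map (renameToken τ') := by
  refine List.map_congr_left fun c hc => ?_
  rw [renameToken, renameToken, h c hc]

theorem map_renameToken_eq_self {τ ρ : Const → Const} {s : List Token}
    (h : ∀ c ∈ s, ρ (τ c.2.2) = c.2.2) : (s.map (renameToken τ)).map (renameToken ρ) = s := by
  rw [List.map_map]
  conv_rhs => rw [← List.map_id s]
  refine List.map_congr_left fun c hc => ?_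
  have := h c hc
  obtain ⟨i, j, k⟩ := c
  by_cases hij : i = 1 ∧ j = 0
  · simp_all [renameToken]
  · simp [renameToken, hij]

theorem exists_bound_tokens (s : List Token) : ∃ N : ℕ, ∀ c ∈ s, c.2.2 < N :=
  ⟨(s.map fun c => c.2.2).sum + 1, fun _ hc => Nat.lt_succ_of_le
    (List.le_sum_of_mem (List.mem_map_of_mem hc))⟩

/-- The string of tokens of a conjunction. -/
def conjTokens (s t : List Token) : List Token :=
  (5, 0, 0) :: (((5, 0, 0) :: (s ++ (5, 0, 0) :: (t ++ [(2, 0, 0)]))) ++ [(2, 0, 0)])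

/-- Conjunction unfolds to `(φ → (ψ → ⊥)) → ⊥`. -/
theorem formulaTokens_inf (φ ψ : Query S) :
    formulaTokens (φ ⊓ ψ) = conjTokens (formulaTokens φ) (formulaTokens ψ) := rfl

theorem rePred_isQueryCode {Q : Set (Query S)} (hQ : IsQueryLanguage Q) :
    REPred fun q : ℕ => ∃ φ ∈ Q, queryCode φ = q := by
  refine (hQ.recursive.to_re.comp (f := str) (primrec_str Primrec.id)).of_eq fun q => ?_
  simp only [queryStr, str_injective.eq_iff]

/-- Implication between the sentences with given codes. -/
def CodeImplies (q r : ℕ) : Prop :=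
  Refutable [(truthVar (tokensOf q) [], true), (truthVar (tokensOf r) [], false)]

/-- The sentence with a given code is a tautology. -/
def CodeTautology (q : ℕ) : Prop := Refutable [(truthVar (tokensOf q) [], false)]

theorem codeImplies_queryCode (φ ψ : Query S) :
    CodeImplies (queryCode φ) (queryCode ψ) ↔ Implies φ ψ := by
  rw [implies_iff_refutable, CodeImplies, tokensOf_queryCode, tokensOf_queryCode]

theorem codeTautology_queryCode (φ : Query S) :
    CodeTautology (queryCode φ) ↔ IsTautology φ := by
  rw [isTautology_iff_refutable, CodeTautology, tokensOf_queryCode]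

theorem rePred_codeImplies {α : Type*} [Primcodable α] {f g : α → ℕ} (hf : Primrec f)
    (hg : Primrec g) : REPred fun x => CodeImplies (f x) (g x) :=
  rePred_refutable.comp (by fun_prop)

theorem rePred_codeTautology {α : Type*} [Primcodable α] {f : α → ℕ} (hf : Primrec f) :
    REPred fun x => CodeTautology (f x) :=
  rePred_refutable.comp (by fun_prop)

/-! ### Codes of databases -/

/-- The data of an entry of a database: predicate, arguments, and the number of the value. -/
abbrev EntryData := (ℕ × ℕ) × List ℕ × ℕ

/-- The data of the entry with a given code. -/
def entryData (e : ℕ) : EntryData := Denumerable.ofNat EntryData e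

@[fun_prop] theorem primrec_entryData {α : Type*} [Primcodable α] {f : α → ℕ}
    (hf : Primrec f) : Primrec fun x => entryData (f x) :=
  (Primrec.ofNat EntryData).comp hf

/-- The number of a value. -/
def valueNum (v : SignType) : ℕ := if v = 1 then 2 else if v = 0 then 1 else 0

theorem valueNum_injective : Function.Injective valueNum := by
  intro v w h
  revert v w
  decide

theorem entryData_code (α : Fact S) (v : SignType) :
    entryData (α.code v) = (α.pred, α.args, valueNum v) := by
  rw [entryData, Fact.code]
  exact Denumerable.ofNat_encode _

theorem code_eq_iff {e : ℕ} {α : Fact S} {v : SignType} :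
    e = α.code v ↔ entryData e = (α.pred, α.args, valueNum v) := by
  constructor
  · rintro rfl
    exact entryData_code α v
  · intro h
    rw [entryData] at h
    rw [Fact.code, ← Denumerable.encode_ofNat (α := EntryData) e, h]
    rfl

theorem code_inj {α β : Fact S} {v w : SignType} : α.code v = β.code w ↔ α = β ∧ v = w := by
  constructor
  · intro h
    have := code_eq_iff.1 h
    rw [entryData_code] at this
    simp only [Prod.mk.injEq] at this
    exact ⟨Fact.ext this.1 this.2.1, valueNum_injective this.2.2⟩
  · rintro ⟨rfl, rfl⟩
    rfl

theorem code_mem_entries {D : Database S} {α : Fact S} {v : SignType} :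
    α.code v ∈ D.entries ↔ D.val α = some v ∧ (0 ≤ v ∨ ¬ α.IsCWA) := by
  constructor
  · rintro ⟨β, w, h1, h2, h3⟩
    obtain ⟨rfl, rfl⟩ := code_inj.1 h3
    exact ⟨h1, h2⟩
  · rintro ⟨h1, h2⟩
    exact ⟨α, v, h1, h2, rfl⟩

/-- Entries omit the value `-1` at CWA-atoms, so inclusion alone is not enough. As `D'` is total on
CWA-atoms, `D` may not observe a CWA-atom that is unobserved in `D'`. -/
theorem extends_iff_entries {D D' : Database S} :
    D.Extends D' ↔ D'.entries ⊆ D.entries ∧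
      ∀ e ∈ D.entries, (entryData e).1 ∈ S.cwa → e ∈ D'.entries := by
  constructor
  · intro h
    refine ⟨?_, ?_⟩
    · rintro _ ⟨α, v, h1, h2, rfl⟩
      exact code_mem_entries.2 ⟨h α v h1, h2⟩
    · rintro _ ⟨α, v, h1, h2, rfl⟩ hc
      rw [entryData_code] at hc
      obtain ⟨w, hw⟩ := D'.cwa_complete α hc
      have := h α w hw
      rw [h1] at this
      cases this
      exact code_mem_entries.2 ⟨hw, h2⟩
  · rintro ⟨h1, h2⟩ α v hv
    by_cases hα : 0 ≤ v ∨ ¬ α.IsCWA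
    · exact (code_mem_entries.1 (h1 (code_mem_entries.2 ⟨hv, hα⟩))).1
    -- Here `D'` has the value `-1` at a CWA-atom; a value `≥ 0` of `D` would be an entry of `D'` as
    -- well.
    · push Not at hα
      obtain ⟨w, hw⟩ := D.cwa_complete α hα.2
      by_cases h0 : 0 ≤ w
      · have := h2 _ (code_mem_entries.2 ⟨hw, Or.inl h0⟩)
          (by rw [entryData_code]; exact hα.2)
        have := (code_mem_entries.1 this).1
        rw [hv] at this
        cases this
        exact absurd h0 (not_le.2 hα.1)
      · rw [hw]
        have : ∀ v w : SignType, v < 0 → ¬ 0 ≤ w → some w = some v := by decide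
        exact this v w hα.1 h0

theorem database_ext_entries {D D' : Database S} (h : D.entries = D'.entries) : D = D' := by
  have h1 : D.Extends D' := extends_iff_entries.2 ⟨h.ge, fun e he _ => h ▸ he⟩
  have h2 : D'.Extends D := extends_iff_entries.2 ⟨h.le, fun e he _ => h ▸ he⟩
  refine Database.ext (funext fun α => Option.ext fun v => ⟨h2 α v, h1 α v⟩)

/-- The list of entries with a given code. -/
def entriesOf (d : ℕ) : List ℕ := Denumerable.ofNat (List ℕ) d

@[fun_prop] theorem primrec_entriesOf {α : Type*} [Primcodable α] {f : α → ℕ}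
    (hf : Primrec f) : Primrec fun x => entriesOf (f x) :=
  (Primrec.ofNat (List ℕ)).comp hf

theorem entriesOf_code (D : Database S) :
    entriesOf D.code = D.entries_finite.toFinset.sort (· ≤ ·) :=
  Denumerable.ofNat_encode _

theorem mem_entriesOf_code {D : Database S} {e : ℕ} : e ∈ entriesOf D.code ↔ e ∈ D.entries := by
  rw [entriesOf_code, Finset.mem_sort, Set.Finite.mem_toFinset]

theorem database_code_injective : Function.Injective (Database.code : Database S → ℕ) := by
  intro D D' h
  refine database_ext_entries (Set.ext fun e => ?_)
  rw [← mem_entriesOf_code, ← mem_entriesOf_code, h]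

theorem code_eq_of_sortedLT {D : Database S} {d : ℕ} (hs : (entriesOf d).Pairwise (· < ·))
    (h : ∀ e, e ∈ entriesOf d ↔ e ∈ D.entries) : D.code = d := by
  have h1 : entriesOf D.code = entriesOf d := by
    rw [entriesOf_code]
    refine List.Perm.eq_of_pairwise (le := (· ≤ ·)) ?_ (Finset.pairwise_sort _ _) (hs.imp le_of_lt) ?_
    · intro a b _ _ hab hba
      exact le_antisymm hab hba
    · refine (List.perm_ext_iff_of_nodup (Finset.sort_nodup _ _) (hs.imp ne_of_lt)).2 fun e => ?_
      rw [Finset.mem_sort, Set.Finite.mem_toFinset, h]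
  exact Equiv.injective (Denumerable.eqv (List ℕ)).symm h1

theorem sortedLT_entriesOf_code (D : Database S) :
    (entriesOf D.code).Pairwise (· < ·) := by
  rw [entriesOf_code]
  exact (Finset.sortedLT_sort _).pairwise

/-! ### The set of codes of databases -/

/-- The conditions on an entry of a database. -/
def IsEntry (S : Signatures) (x : EntryData) : Prop :=
  x.1 ∈ S.dbPreds ∧ x.2.1.length = x.1.1 ∧ x.2.2 < 3 ∧ (0 < x.2.2 ∨ x.1 ∉ S.cwa)

theorem isEntry_iff {x : EntryData} :
    IsEntry S x ↔ ∃ (α : Fact S) (v : SignType),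
      (0 ≤ v ∨ ¬ α.IsCWA) ∧ x = (α.pred, α.args, valueNum v) := by
  constructor
  · rintro ⟨h1, h2, h3, h4⟩
    obtain ⟨p, a, w⟩ := x
    have hv : ∀ w < 3, ∃ v, valueNum v = w ∧ (0 < w → 0 ≤ v) := by decide
    obtain ⟨v, rfl, hv⟩ := hv w h3
    exact ⟨⟨p, a, h1, h2⟩, v, h4.imp hv id, rfl⟩
  · rintro ⟨α, v, h, rfl⟩
    have hv : ∀ v, valueNum v < 3 ∧ (0 ≤ v → 0 < valueNum v) := by decide
    exact ⟨α.pred_mem, α.length_eq, (hv v).1, h.imp (hv v).2 id⟩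

/-- The number `d` satisfies the conditions for codes of databases. -/
def IsDatabaseCode (S : Signatures) (d : ℕ) : Prop :=
  (∀ e ∈ entriesOf d, IsEntry S (entryData e)) ∧
  (∀ i ∈ List.range (entriesOf d).length, ∀ e ∈ (entriesOf d).take i,
    e < (entriesOf d).getD i 0) ∧
  ∀ e ∈ entriesOf d, ∀ e' ∈ entriesOf d, (entryData e).1 = (entryData e').1 →
    (entryData e).2.1 = (entryData e').2.1 → e = e'

/-- Brings pairwise conditions into a form with bounded quantifiers over lists. -/
theorem pairwise_iff_forall_take {R : ℕ → ℕ → Prop} {l : List ℕ} :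
    l.Pairwise R ↔ ∀ i ∈ List.range l.length, ∀ e ∈ l.take i, R e (l.getD i 0) := by
  rw [List.pairwise_iff_getElem]
  constructor
  · intro h i hi e he
    have hi : i < l.length := by simpa using hi
    obtain ⟨j, hj, rfl⟩ := List.mem_iff_getElem.1 he
    rw [List.getD_eq_getElem _ _ hi, List.getElem_take]
    exact h _ _ _ _ (by simp at hj; omega)
  · intro h i j hi hj hij
    have := h j (by simpa using hj) l[i]
      (List.mem_iff_getElem.2 ⟨i, by simp; omega, by simp⟩)
    rwa [List.getD_eq_getElem _ _ hj] at this

theorem isDatabaseCode_code (D : Database S) : IsDatabaseCode S D.code := by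
  refine ⟨fun e he => ?_, pairwise_iff_forall_take.1 (sortedLT_entriesOf_code D), fun e he e' he' h h' => ?_⟩
  · obtain ⟨α, v, -, h, rfl⟩ := mem_entriesOf_code.1 he
    exact isEntry_iff.2 ⟨α, v, h, entryData_code α v⟩
  · obtain ⟨α, v, hv, -, rfl⟩ := mem_entriesOf_code.1 he
    obtain ⟨β, w, hw, -, rfl⟩ := mem_entriesOf_code.1 he'
    rw [entryData_code, entryData_code] at h h'
    obtain rfl : α = β := Fact.ext h h'
    rw [hv] at hw
    cases hw
    rfl

open Classical in
/-- The values of the database with a given code. -/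
noncomputable def valOfCode (S : Signatures) (d : ℕ) (α : Fact S) : Option SignType :=
  if h : ∃ v, α.code v ∈ entriesOf d then some h.choose
  else if α.IsCWA then some (-1) else none

/-- The database is read off from the listed entries, with `-1` at all other CWA-atoms; since the
list is strictly increasing, it is the canonical list of entries. -/
theorem exists_code_eq {d : ℕ} (hd : IsDatabaseCode S d) : ∃ D : Database S, D.code = d := by
  have hval : ∀ (α : Fact S) (v : SignType), valOfCode S d α = some v →
      α.code v ∈ entriesOf d ∨ (α.IsCWA ∧ v = -1) := by
    intro α v h
    unfold valOfCode at h
    split_ifs at h with h1 h2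
    · cases h
      exact Or.inl h1.choose_spec
    · cases h
      exact Or.inr ⟨h2, rfl⟩
  have hval' : ∀ (α : Fact S) (v : SignType), α.code v ∈ entriesOf d →
      valOfCode S d α = some v := by
    intro α v h
    have h1 : ∃ v, α.code v ∈ entriesOf d := ⟨v, h⟩
    rw [valOfCode, dif_pos h1]
    -- The last condition on codes allows only one value per atom, so the chosen value is `v`.
    have := hd.2.2 _ h _ h1.choose_spec (by simp [entryData_code]) (by simp [entryData_code])
    rw [(code_inj.1 this).2]
  have hfin : {α : Fact S | ∃ v, α.code v ∈ entriesOf d}.Finite := by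
    refine Set.Finite.subset (s := ⋃ v : SignType, (fun α : Fact S => α.code v) ⁻¹'
      {e | e ∈ entriesOf d}) (Set.finite_iUnion fun v => ?_) ?_
    · exact Set.Finite.preimage (fun α _ β _ h => (code_inj.1 h).1) (List.finite_toSet _)
    · rintro α ⟨v, h⟩
      exact Set.mem_iUnion.2 ⟨v, h⟩
  let D : Database S :=
    { val := valOfCode S d
      finite_observed := by
        refine hfin.subset ?_
        rintro α ⟨v, hv, h0⟩
        rcases hval α v hv with h | ⟨-, rfl⟩
        · exact ⟨v, h⟩
        · exact absurd h0 (by decide)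
      cwa_complete := by
        intro α hα
        by_cases h : ∃ v, α.code v ∈ entriesOf d
        · exact ⟨_, hval' α _ h.choose_spec⟩
        · exact ⟨-1, by rw [valOfCode, dif_neg h, if_pos hα]⟩
      finite_owa := by
        refine hfin.subset ?_
        rintro α ⟨hα, v, hv⟩
        rcases hval α v hv with h | ⟨h, -⟩
        · exact ⟨v, h⟩
        · exact absurd h hα }
  refine ⟨D, code_eq_of_sortedLT (pairwise_iff_forall_take.2 hd.2.1) fun e => ⟨fun he => ?_, ?_⟩⟩
  · obtain ⟨α, v, h, hx⟩ := isEntry_iff.1 (hd.1 e he)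
    obtain rfl := code_eq_iff.2 hx
    exact code_mem_entries.2 ⟨hval' α v he, h⟩
  · rintro ⟨α, v, hv, h, rfl⟩
    rcases hval α v hv with h' | ⟨hc, rfl⟩
    · exact h'
    · rcases h with h | h
      · exact absurd h (by decide)
      · exact absurd hc h

/-- The value `0` has number `1`, and it is never omitted from the entries. -/
theorem isPositive_iff {D : Database S} :
    D.IsPositive ↔ ∀ e ∈ entriesOf D.code, ¬ (entryData e).2.2 = 1 := by
  constructor
  · intro h e he h1
    obtain ⟨α, v, hv, -, rfl⟩ := mem_entriesOf_code.1 he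
    rw [entryData_code] at h1
    have : ∀ v, valueNum v = 1 → v = 0 := by decide
    obtain rfl := this v h1
    exact h α hv
  · intro h α hα
    refine h (α.code 0) (mem_entriesOf_code.2 (code_mem_entries.2 ⟨hα, Or.inl le_rfl⟩)) ?_
    rw [entryData_code]
    rfl

theorem rePred_isDatabaseCode (S : Signatures) : REPred (IsDatabaseCode S) := by
  have hcwa : REPred fun x : EntryData => x.1 ∉ S.cwa :=
    S.cwa_recursive.not.to_re.comp (f := fun x : EntryData => x.1) (by fun_prop)
  have hdb : REPred fun x : EntryData => x.1 ∈ S.dbPreds :=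
    S.dbPreds_recursive.to_re.comp (f := fun x : EntryData => x.1) (by fun_prop)
  have hentry : REPred (IsEntry S) :=
    hdb.and ((PrimrecPred.rePred (by fun_prop)).and ((PrimrecPred.rePred (by fun_prop)).and
      ((PrimrecPred.rePred (by fun_prop)).or hcwa)))
  refine REPred.and ?_ (REPred.and ?_ ?_)
  · exact REPred.forall_mem (hentry.comp (f := fun x : ℕ × ℕ => entryData x.2) (by fun_prop))
      (by fun_prop)
  · exact PrimrecPred.rePred (primrecPred_forall_mem (by fun_prop) (primrecPred_forall_mem
      (by fun_prop) (by fun_prop)))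
  · refine PrimrecPred.rePred (primrecPred_forall_mem (by fun_prop) (primrecPred_forall_mem
      (by fun_prop) ?_))
    refine (PrimrecPred.or (PrimrecPred.not (primrecPred_eq
      (f := fun x : (ℕ × ℕ) × ℕ => ((entryData x.1.2).1, (entryData x.1.2).2.1))
      (g := fun x => ((entryData x.2).1, (entryData x.2).2.1)) (by fun_prop) (by fun_prop)))
      (primrecPred_eq (f := fun x : (ℕ × ℕ) × ℕ => x.1.2) (g := fun x => x.2)
        (by fun_prop) (by fun_prop))).of_eq fun x => ?_
    rw [← imp_iff_not_or, Prod.mk.injEq, and_imp]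

theorem rePred_exists_code_eq {𝒟 : Set (Database S)}
    (h𝒟 : 𝒟 = allDatabases S ∨ 𝒟 = positiveDatabases S) :
    REPred fun d : ℕ => ∃ D ∈ 𝒟, D.code = d := by
  rcases h𝒟 with rfl | rfl
  · refine (rePred_isDatabaseCode S).of_eq fun d => ⟨fun h => ?_, ?_⟩
    · obtain ⟨D, hD⟩ := exists_code_eq h
      exact ⟨D, trivial, hD⟩
    · rintro ⟨D, -, rfl⟩
      exact isDatabaseCode_code D
  · refine ((rePred_isDatabaseCode S).and (PrimrecPred.rePred (primrecPred_forall_mem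
      (f := entriesOf) (p := fun _ e => ¬ (entryData e).2.2 = 1) (by fun_prop)
      (PrimrecPred.not (by fun_prop))))).of_eq fun d => ⟨fun h => ?_, ?_⟩
    · obtain ⟨D, rfl⟩ := exists_code_eq h.1
      exact ⟨D, isPositive_iff.2 h.2, rfl⟩
    · rintro ⟨D, hD, rfl⟩
      exact ⟨isDatabaseCode_code D, isPositive_iff.1 hD⟩

/-! ### Extension and renaming in terms of codes -/

/-- The database with code `d` extends the one with code `d'`. -/
def CodeExtends (S : Signatures) (d d' : ℕ) : Prop :=
  entriesOf d' ⊆ entriesOf d ∧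
    ∀ e ∈ entriesOf d, (entryData e).1 ∉ S.cwa ∨ e ∈ entriesOf d'

theorem codeExtends_code {D D' : Database S} : CodeExtends S D.code D'.code ↔ D.Extends D' := by
  rw [extends_iff_entries, CodeExtends]
  simp only [mem_entriesOf_code, List.subset_def, Set.subset_def, imp_iff_not_or]

/-- Membership in `S.cwa` enters negatively; its decidability is what makes the condition
enumerable. -/
theorem rePred_codeExtends {α : Type*} [Primcodable α] {f g : α → ℕ} (hf : Primrec f)
    (hg : Primrec g) : REPred fun x => CodeExtends S (f x) (g x) := by
  refine REPred.and (PrimrecPred.rePred (by fun_prop)) (REPred.forall_mem (REPred.or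
    (S.cwa_recursive.not.to_re.comp (f := fun x : α × ℕ => (entryData x.2).1) (by fun_prop))
    (PrimrecPred.rePred (by fun_prop))) (by fun_prop))

/-- Renaming of the constants of an entry. -/
def renameEntry (τ : Const → Const) (e : ℕ) : ℕ :=
  Encodable.encode ((entryData e).1, (entryData e).2.1.map τ, (entryData e).2.2)

theorem renameEntry_code (τ : Const → Const) (α : Fact S) (v : SignType) :
    renameEntry τ (α.code v) = (α.rename τ).code v := by
  rw [renameEntry, entryData_code]
  rfl

theorem entryData_renameEntry (τ : Const → Const) (e : ℕ) : entryData (renameEntry τ e) =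
    ((entryData e).1, (entryData e).2.1.map τ, (entryData e).2.2) :=
  Denumerable.ofNat_encode _

theorem rename_injective {τ : Const → Const} (hτ : Function.Injective τ) :
    Function.Injective (Fact.rename τ : Fact S → Fact S) := by
  intro α β h
  have h1 := congrArg Fact.pred h
  have h2 := congrArg Fact.args h
  exact Fact.ext h1 (List.map_injective_iff.2 hτ h2)

theorem val_rename {τ : Const → Const} (hτ : Function.Injective τ) (D : Database S)
    (α : Fact S) : (D.rename τ).val (α.rename τ) = D.val α := by
  have h : ∃ β : Fact S, β.rename τ = α.rename τ := ⟨α, rfl⟩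
  change D.renameVal τ (α.rename τ) = _
  rw [Database.renameVal, dif_pos h, rename_injective hτ h.choose_spec]

/-- CWA-atoms outside the range of the renaming receive `-1` and contribute no entry. -/
theorem entries_rename {τ : Const → Const} (hτ : Function.Injective τ) (D : Database S) :
    (D.rename τ).entries = renameEntry τ '' D.entries := by
  ext e
  constructor
  · rintro ⟨β, v, hv, h, rfl⟩
    have hv' : D.renameVal τ β = some v := hv
    rcases D.renameVal_eq τ β with ⟨α, rfl, hα⟩ | ⟨hβ, hβ'⟩ | ⟨-, hβ⟩
    · rw [hα] at hv'
      exact ⟨α.code v, code_mem_entries.2 ⟨hv', h⟩, renameEntry_code τ α v⟩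
    · rw [hβ'] at hv'
      cases hv'
      rcases h with h | h
      · exact absurd h (by decide)
      · exact absurd hβ h
    · rw [hβ] at hv'
      cases hv'
  · rintro ⟨_, ⟨α, v, hv, h, rfl⟩, rfl⟩
    rw [renameEntry_code]
    exact code_mem_entries.2 ⟨by rw [val_rename hτ, hv], h⟩

/-- The number `d'` is the code of the database that results from the one with code `d` by
renaming constants. -/
def CodeRename (t : List ℕ) (d d' : ℕ) : Prop :=
  entriesOf d' ⊆ (entriesOf d).map (renameEntry (listRename t)) ∧
    (entriesOf d).map (renameEntry (listRename t)) ⊆ entriesOf d'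

theorem primrecPred_codeRename {α : Type*} [Primcodable α] {t : α → List ℕ} {f g : α → ℕ}
    (ht : Primrec t) (hf : Primrec f) (hg : Primrec g) :
    PrimrecPred fun x => CodeRename (t x) (f x) (g x) := by
  unfold CodeRename renameEntry
  fun_prop

/-- Renaming may destroy the order of the entries, so the lists are compared as sets. -/
theorem codeRename_code {t : List ℕ} (ht : t.Nodup) {D D' : Database S} :
    CodeRename t D.code D'.code ↔ D' = D.rename (listRename t) := by
  have h := entries_rename (listRename_injective ht) D
  constructor
  · rintro ⟨h1, h2⟩
    refine database_ext_entries ?_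
    rw [h]
    ext e
    have h1 := @h1 e
    have h2 := @h2 e
    simp only [List.mem_map, mem_entriesOf_code] at h1 h2
    exact ⟨h1, h2⟩
  · rintro rfl
    constructor <;> intro e <;> simp [mem_entriesOf_code, h]

theorem exists_bound_database (D : Database S) :
    ∃ N : ℕ, ∀ e ∈ D.entries, ∀ c ∈ (entryData e).2.1, c < N := by
  refine ⟨((entriesOf D.code).flatMap fun e => (entryData e).2.1).sum + 1, fun e he c hc =>
    Nat.lt_succ_of_le (List.le_sum_of_mem ?_)⟩
  exact List.mem_flatMap.2 ⟨e, mem_entriesOf_code.2 he, hc⟩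

/-- Only the finitely many constants occurring in entries matter. -/
theorem database_rename_congr {τ τ' : Const → Const} (hτ : Function.Injective τ)
    (hτ' : Function.Injective τ') {D : Database S}
    (h : ∀ e ∈ D.entries, ∀ c ∈ (entryData e).2.1, τ c = τ' c) : D.rename τ = D.rename τ' := by
  refine database_ext_entries ?_
  rw [entries_rename hτ, entries_rename hτ']
  refine Set.image_congr fun e he => ?_
  rw [renameEntry, renameEntry, List.map_congr_left (h e he)]

theorem database_rename_rename_eq_self {τ ρ : Const → Const} (hτ : Function.Injective τ)
    (hρ : Function.Injective ρ) {D : Database S}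
    (h : ∀ e ∈ D.entries, ∀ c ∈ (entryData e).2.1, ρ (τ c) = c) :
    (D.rename τ).rename ρ = D := by
  refine database_ext_entries ?_
  rw [entries_rename hρ, entries_rename hτ, Set.image_image]
  conv_rhs => rw [← Set.image_id D.entries]
  refine Set.image_congr fun e he => ?_
  rw [renameEntry, entryData_renameEntry, List.map_map]
  have : (entryData e).2.1.map (ρ ∘ τ) = (entryData e).2.1 := by
    conv_rhs => rw [← List.map_id (entryData e).2.1]
    exact List.map_congr_left (h e he)
  rw [this]
  exact Denumerable.encode_ofNat (α := EntryData) e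

theorem rename_mem {𝒟 : Set (Database S)}
    (h𝒟 : 𝒟 = allDatabases S ∨ 𝒟 = positiveDatabases S) {τ : Const → Const}
    (hτ : Function.Injective τ) {D : Database S} (hD : D ∈ 𝒟) : D.rename τ ∈ 𝒟 := by
  rcases h𝒟 with rfl | rfl
  · trivial
  · refine isPositive_iff.2 fun e he => ?_
    rw [mem_entriesOf_code, entries_rename hτ] at he
    obtain ⟨e, he, rfl⟩ := he
    rw [entryData_renameEntry]
    exact isPositive_iff.1 hD e (mem_entriesOf_code.2 he)

/-! ### The procedure on codes -/

theorem rePred_accepts {α : Type*} [Primcodable α] {M : α → Machine} {w : α → List Bool}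
    (hM : Primrec M) (hw : Primrec w) : REPred fun x => Accepts (M x) (w x) := by
  refine rePred_iff_exists_primrec.2
    ⟨fun x k => (M x).evaln k (Encodable.encode (w x)) = some 1, ?_, fun x => ?_⟩
  · refine primrecPred_eq (Nat.Partrec.Code.primrec_evaln.comp
      (f := fun x : (ℕ × Machine) × ℕ => Nat.Partrec.Code.evaln x.1.1 x.1.2 x.2)
      (g := fun x : α × ℕ => ((x.2, M x.1), Encodable.encode (w x.1))) ?_) (Primrec.const _)
    fun_prop
  · exact Nat.Partrec.Code.evaln_complete

/-- The rules of the procedure in terms of codes of machines, databases, and queries. -/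
def ProcedureRule (𝒟 : Set (Database S)) (Q : Set (Query S))
    (x : List (ℕ × ℕ × ℕ) × ℕ × ℕ × ℕ) : Prop :=
  (x.1 = [] ∧ Accepts (Denumerable.ofNat Machine x.2.1) (str (Nat.pair x.2.2.1 x.2.2.2))) ∨
  (x.1 = [] ∧ CodeTautology x.2.2.2) ∨
  (∃ r : ℕ, x.1 = [(x.2.1, x.2.2.1, r)] ∧ (∃ ψ ∈ Q, queryCode ψ = r) ∧
    CodeImplies r x.2.2.2) ∨
  (∃ r : ℕ × ℕ, x.1 = [(x.2.1, x.2.2.1, r.1), (x.2.1, x.2.2.1, r.2)] ∧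
    (∃ ψ ∈ Q, queryCode ψ = r.1) ∧ (∃ χ ∈ Q, queryCode χ = r.2) ∧
    tokensOf x.2.2.2 = conjTokens (tokensOf r.1) (tokensOf r.2)) ∨
  (∃ d : ℕ, x.1 = [(x.2.1, d, x.2.2.2)] ∧ (∃ D ∈ 𝒟, D.code = d) ∧
    CodeExtends S x.2.2.1 d) ∨
  (∃ y : List ℕ × ℕ × ℕ, x.1 = [(x.2.1, y.2.1, y.2.2)] ∧ y.1.Nodup ∧ (∃ D ∈ 𝒟, D.code = y.2.1) ∧
    (∃ ψ ∈ Q, queryCode ψ = y.2.2) ∧ CodeRename y.1 x.2.2.1 y.2.1 ∧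
    tokensOf y.2.2 = (tokensOf x.2.2.2).map (renameToken (listRename y.1)))

theorem primrecPred_nodup {α : Type*} [Primcodable α] {f : α → List ℕ} (hf : Primrec f) :
    PrimrecPred fun x => (f x).Nodup :=
  (primrecPred_forall_mem (by fun_prop) (primrecPred_forall_mem (by fun_prop)
    (PrimrecPred.not (by fun_prop)))).of_eq fun x =>
      (pairwise_iff_forall_take (R := fun a b => ¬ a = b) (l := f x)).symm

variable {𝒟 : Set (Database S)} {Q : Set (Query S)}

theorem rePred_procedureRule (h𝒟 : 𝒟 = allDatabases S ∨ 𝒟 = positiveDatabases S)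
    (hQ : IsQueryLanguage Q) : REPred (ProcedureRule 𝒟 Q) := by
  have hD : ∀ {α : Type} [Primcodable α] {f : α → ℕ}, Primrec f →
      REPred fun x => ∃ D ∈ 𝒟, D.code = f x := fun hf => (rePred_exists_code_eq h𝒟).comp hf
  have hq : ∀ {α : Type} [Primcodable α] {f : α → ℕ}, Primrec f →
      REPred fun x => ∃ ψ ∈ Q, queryCode ψ = f x := fun hf => (rePred_isQueryCode hQ).comp hf
  refine REPred.or ?_ (REPred.or ?_ (REPred.or ?_ (REPred.or ?_ (REPred.or ?_ ?_))))
  · exact (PrimrecPred.rePred (by fun_prop)).and (rePred_accepts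
      ((Primrec.ofNat Machine).comp (by fun_prop)) (by fun_prop))
  · exact (PrimrecPred.rePred (by fun_prop)).and (rePred_codeTautology (by fun_prop))
  · exact REPred.exists ((PrimrecPred.rePred (by fun_prop)).and ((hq (by fun_prop)).and
      (rePred_codeImplies (by fun_prop) (by fun_prop))))
  · refine REPred.exists ((PrimrecPred.rePred (by fun_prop)).and ((hq (by fun_prop)).and
      ((hq (by fun_prop)).and (PrimrecPred.rePred ?_))))
    unfold conjTokens
    fun_prop
  · exact REPred.exists ((PrimrecPred.rePred (by fun_prop)).and ((hD (by fun_prop)).and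
      (rePred_codeExtends (by fun_prop) (by fun_prop))))
  · refine REPred.exists ((PrimrecPred.rePred (by fun_prop)).and
      ((PrimrecPred.rePred (primrecPred_nodup (by fun_prop))).and ((hD (by fun_prop)).and
      ((hq (by fun_prop)).and ((PrimrecPred.rePred (primrecPred_codeRename (by fun_prop)
        (by fun_prop) (by fun_prop))).and (PrimrecPred.rePred ?_))))))
    unfold renameToken
    fun_prop

/-- Each rule on codes is matched by a rule of the procedure. For conjunctions and renamings the
code fixes the sentence only up to its tokens, and an extra application of rule (iii) repairs this.
-/
theorem procedureAccepts_of_generated (hQ : IsQueryLanguage Q) {x : ℕ × ℕ × ℕ} (h : Generated (ProcedureRule 𝒟 Q) x) :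
    ∀ D ∈ 𝒟, ∀ φ ∈ Q, D.code = x.2.1 → queryCode φ = x.2.2 →
      ProcedureAccepts 𝒟 Q (Denumerable.ofNat Machine x.1) D φ := by
  induction h with
  | rule l x hR _ ih =>
    obtain ⟨m, d, q⟩ := x
    rintro D hD φ hφ rfl rfl
    rcases hR with ⟨-, h⟩ | ⟨-, h⟩ | ⟨r, hl, ⟨ψ, hψ, rfl⟩, h⟩ |
      ⟨⟨r, s⟩, hl, ⟨ψ, hψ, rfl⟩, ⟨χ, hχ, rfl⟩, h⟩ | ⟨d, hl, ⟨D', hD', rfl⟩, h⟩ |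
      ⟨⟨t, d, q⟩, hl, ht, ⟨D', hD', rfl⟩, ⟨ψ, hψ, rfl⟩, hr, hs⟩
    · exact .simulate D φ h
    · exact .tautology D φ ((codeTautology_queryCode φ).1 h)
    · exact .implication D φ ψ hψ ((codeImplies_queryCode ψ φ).1 h)
        (ih (m, D.code, queryCode ψ) (by rw [show l = _ from hl]; simp) D hD ψ hψ rfl rfl)
    · have h1 := ih (m, D.code, queryCode ψ) (by rw [show l = _ from hl]; simp) D hD ψ hψ rfl rfl
      have h2 := ih (m, D.code, queryCode χ) (by rw [show l = _ from hl]; simp) D hD χ hχ rfl rfl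
      refine .implication D φ (ψ ⊓ χ) (hQ.conj ψ hψ χ hχ) (implies_of_formulaTokens_eq ?_)
        (.conj D ψ χ hψ hχ h1 h2)
      simp only [tokensOf_queryCode] at h
      rw [formulaTokens_inf, h]
    · exact .extension D D' φ hD' (codeExtends_code.1 h)
        (ih (m, D'.code, queryCode φ) (by rw [show l = _ from hl]; simp) D' hD' φ hφ rfl rfl)
    · have h1 := ih (m, D'.code, queryCode ψ) (by rw [show l = _ from hl]; simp)
        D' hD' ψ hψ rfl rfl
      have hD' : D' = D.rename (listRename t) := (codeRename_code ht).1 hr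
      subst hD'
      refine .rename (listRename t) D φ (listRename_injective ht) ?_
      refine .implication _ _ ψ hψ (implies_of_formulaTokens_eq ?_) h1
      simp only [tokensOf_queryCode] at hs
      rw [formulaTokens_renameQuery, hs]

theorem generated_of_procedureAccepts (h𝒟 : 𝒟 = allDatabases S ∨ 𝒟 = positiveDatabases S)
    (hQ : IsQueryLanguage Q) {M : Machine} {D : Database S} {φ : Query S}
    (h : ProcedureAccepts 𝒟 Q M D φ) (hD : D ∈ 𝒟) (hφ : φ ∈ Q) :
    Generated (ProcedureRule 𝒟 Q) (Encodable.encode M, D.code, queryCode φ) := by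
  induction h with
  | simulate D φ h =>
    refine .rule [] _ (Or.inl ⟨rfl, ?_⟩) (by simp)
    simpa [pairStr] using h
  | tautology D φ h =>
    exact .rule [] _ (Or.inr (Or.inl ⟨rfl, (codeTautology_queryCode φ).2 h⟩)) (by simp)
  | implication D φ ψ hψ h _ ih =>
    refine .rule [(Encodable.encode M, D.code, queryCode ψ)] _ (Or.inr (Or.inr (Or.inl
      ⟨_, rfl, ⟨ψ, hψ, rfl⟩, (codeImplies_queryCode ψ φ).2 h⟩))) ?_
    simpa using ih hD hψ
  | conj D ψ χ hψ hχ _ _ ih1 ih2 =>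
    refine .rule [(Encodable.encode M, D.code, queryCode ψ),
      (Encodable.encode M, D.code, queryCode χ)] _ (Or.inr (Or.inr (Or.inr (Or.inl
      ⟨(queryCode ψ, queryCode χ), rfl, ⟨ψ, hψ, rfl⟩, ⟨χ, hχ, rfl⟩, ?_⟩)))) ?_
    · simp only [tokensOf_queryCode, formulaTokens_inf]
    · simpa using ⟨ih1 hD hψ, ih2 hD hχ⟩
  | extension D D' φ hD' h _ ih =>
    refine .rule [(Encodable.encode M, D'.code, queryCode φ)] _ (Or.inr (Or.inr (Or.inr (Or.inr
      (Or.inl ⟨_, rfl, ⟨D', hD', rfl⟩, codeExtends_code.2 h⟩))))) ?_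
    simpa using ih hD' hφ
  | rename τ D φ hτ _ ih =>
    obtain ⟨N, hN⟩ := exists_bound_database D
    obtain ⟨N', hN'⟩ := exists_bound_tokens (formulaTokens φ)
    -- The arbitrary injection is replaced by a finitely described one that agrees with it on all
    -- constants of `D` and `φ`.
    obtain ⟨t, ht, hτt⟩ := exists_listRename hτ (N + N')
    have h1 : D.rename τ = D.rename (listRename t) :=
      database_rename_congr hτ (listRename_injective ht) fun e he c hc =>
        (hτt c ((hN e he c hc).trans_le (Nat.le_add_right _ _))).symm
    have h2 : (formulaTokens φ).map (renameToken τ) =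
        (formulaTokens φ).map (renameToken (listRename t)) :=
      map_renameToken_congr fun c hc =>
        (hτt _ ((hN' c hc).trans_le (Nat.le_add_left _ _))).symm
    have hDτ := rename_mem h𝒟 hτ hD
    have hφτ := hQ.rename τ hτ φ hφ
    refine .rule [(Encodable.encode M, (D.rename τ).code, queryCode (renameQuery τ φ))] _
      (Or.inr (Or.inr (Or.inr (Or.inr (Or.inr ⟨(t, (D.rename τ).code,
        queryCode (renameQuery τ φ)), rfl, ht, ⟨_, hDτ, rfl⟩, ⟨_, hφτ, rfl⟩,
        (codeRename_code ht).2 h1, ?_⟩))))) ?_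
    · simp only [tokensOf_queryCode, formulaTokens_renameQuery, h2]
    · simpa using ih hDτ hφτ

theorem exists_machine_of_rePred {p : ℕ → Prop} (hp : REPred p) :
    ∃ c : Machine, ∀ n, 1 ∈ c.eval n ↔ p n := by
  have h : Partrec fun n => (Part.assert (p n) fun _ => Part.some ()).map fun _ => 1 :=
    Partrec.map hp (Computable.const 1).to₂
  obtain ⟨c, hc⟩ := Nat.Partrec.Code.exists_code.1 (Partrec.nat_iff.1 h)
  refine ⟨c, fun n => ?_⟩
  rw [hc]
  simp

theorem accepts_star {U M : Machine} {w : List Bool} : Accepts (star U M) w ↔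
    1 ∈ U.eval (Nat.pair (Encodable.encode M) (Encodable.encode w)) := by
  rw [Accepts, star, Nat.Partrec.Code.eval_curry]

theorem exists_implements (h𝒟 : 𝒟 = allDatabases S ∨ 𝒟 = positiveDatabases S)
    (hQ : IsQueryLanguage Q) : ∃ U : Machine, Implements 𝒟 Q U := by
  obtain ⟨U, hU⟩ := exists_machine_of_rePred
    -- The input of `U` pairs the code of `M` with that of a string, which is decoded into the codes
    -- of a database and a sentence.
    ((rePred_generated (rePred_procedureRule h𝒟 hQ)).comp
      (f := fun n : ℕ => (n.unpair.1,
        (ofStr ((Encodable.decode n.unpair.2 : Option (List Bool)).getD [])).unpair))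
      (by fun_prop))
  refine ⟨U, fun M D hD φ hφ => ?_⟩
  rw [accepts_star, hU]
  simp only [Nat.unpair_pair, Encodable.encodek, Option.getD_some, pairStr, ofStr_str]
  constructor
  · intro h
    simpa using procedureAccepts_of_generated hQ h D hD φ hφ rfl rfl
  · exact fun h => generated_of_procedureAccepts h𝒟 hQ h hD hφ

/-! ### The canonical formalism -/

theorem isKB_machineKB (h𝒟 : 𝒟 = allDatabases S ∨ 𝒟 = positiveDatabases S)
    (hQ : IsQueryLanguage Q) {U : Machine} (hU : Implements 𝒟 Q U) (M : Machine) :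
    IsKB 𝒟 Q (machineKB 𝒟 Q (star U M)) := by
  have hmem : ∀ D φ, (D, φ) ∈ machineKB 𝒟 Q (star U M) ↔
      D ∈ 𝒟 ∧ φ ∈ Q ∧ ProcedureAccepts 𝒟 Q M D φ := fun D φ =>
    and_congr_right fun hD => and_congr_right fun hφ => hU M D hD φ hφ
  refine ⟨fun x hx => ⟨hx.1, hx.2.1⟩, ?_, ?_, ?_, ?_, ?_⟩
  · exact fun D hD φ hφ h => (hmem D φ).2 ⟨hD, hφ, .tautology D φ h⟩
  · intro D φ h ψ hψ hi
    obtain ⟨hD, hφ, h⟩ := (hmem D φ).1 h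
    exact (hmem D ψ).2 ⟨hD, hψ, .implication D ψ φ hφ hi h⟩
  · intro D φ ψ h1 h2
    obtain ⟨hD, hφ, h1⟩ := (hmem D φ).1 h1
    obtain ⟨-, hψ, h2⟩ := (hmem D ψ).1 h2
    exact (hmem _ _).2 ⟨hD, hQ.conj φ hφ ψ hψ, .conj D φ ψ hφ hψ h1 h2⟩
  · intro D φ h D₀ hD₀ he
    obtain ⟨hD, hφ, h⟩ := (hmem D φ).1 h
    exact (hmem _ _).2 ⟨hD₀, hφ, .extension D₀ D φ hD he h⟩
  · intro τ hτ D φ h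
    obtain ⟨hD, hφ, h⟩ := (hmem D φ).1 h
    obtain ⟨N, hN⟩ := exists_bound_database D
    obtain ⟨N', hN'⟩ := exists_bound_tokens (formulaTokens φ)
    -- Rule (vi) applied with `ρ` to `τ(D)` and `τ(φ)` leads back to `D` and a sentence with the
    -- tokens of `φ`.
    obtain ⟨ρ, hρ, hρτ⟩ := exists_rename_leftInverse hτ (N + N')
    refine (hmem _ _).2 ⟨rename_mem h𝒟 hτ hD, hQ.rename τ hτ φ hφ, .rename ρ _ _ hρ ?_⟩
    rw [database_rename_rename_eq_self hτ hρ fun e he c hc =>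
      hρτ c ((hN e he c hc).trans_le (Nat.le_add_right _ _))]
    refine .implication D _ φ hφ (implies_of_formulaTokens_eq ?_) h
    rw [formulaTokens_renameQuery, formulaTokens_renameQuery]
    exact (map_renameToken_eq_self fun c hc =>
      hρτ _ ((hN' c hc).trans_le (Nat.le_add_left _ _))).symm

/-- Makes the choice of `M` in `Theta` harmless. -/
theorem machineStr_star_injective (U : Machine) :
    Function.Injective fun M => machineStr (star U M) := by
  intro M N h
  exact Encodable.encode_injective
    (Nat.Partrec.Code.curry_inj (Encodable.encode_injective (str_injective h))).2

theorem theta_machineStr (U M : Machine) :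
    Theta 𝒟 Q U (machineStr (star U M)) = Part.some (machineKB 𝒟 Q (star U M)) := by
  have h : ∃ N : Machine, machineStr (star U N) = machineStr (star U M) := ⟨M, rfl⟩
  refine Part.eq_some_iff.2 ⟨h, ?_⟩
  exact congrArg (fun N => machineKB 𝒟 Q (star U N)) (machineStr_star_injective U h.choose_spec)

theorem mem_theta {U : Machine} {w : List Bool} {K : Set (Database S × Query S)} :
    K ∈ Theta 𝒟 Q U w ↔ ∃ M, machineStr (star U M) = w ∧ K = machineKB 𝒟 Q (star U M) := by
  constructor
  · rintro ⟨⟨M, rfl⟩, hK⟩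
    refine ⟨M, rfl, ?_⟩
    have : K ∈ Theta 𝒟 Q U (machineStr (star U M)) := ⟨⟨M, rfl⟩, hK⟩
    rw [theta_machineStr] at this
    exact Part.mem_some_iff.1 this
  · rintro ⟨M, rfl, rfl⟩
    rw [theta_machineStr]
    exact Part.mem_some _

theorem le_encode_const (n : ℕ) : n ≤ Encodable.encode (Nat.Partrec.Code.const n) := by
  induction n with
  | zero => exact Nat.zero_le _
  | succ n ih => exact Nat.succ_le_of_lt (ih.trans_lt (Nat.Partrec.Code.encode_lt_comp _ _).2)

/-- The hard-wired number is smaller than the code of the resulting program, so a bounded search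
decides the domain of `Theta`. -/
theorem lt_encode_curry (c : Machine) (n : ℕ) : n < Encodable.encode (c.curry n) :=
  (le_encode_const n).trans_lt ((Nat.Partrec.Code.encode_lt_pair _ _).1.trans
    (Nat.Partrec.Code.encode_lt_comp _ _).2)

theorem primrec_curry {α : Type*} [Primcodable α] (c : Machine) {f : α → ℕ} (hf : Primrec f) :
    Primrec fun x => c.curry (f x) :=
  Nat.Partrec.Code.primrec₂_curry.comp (Primrec.const c) hf

theorem computablePred_theta_dom (𝒟 : Set (Database S)) (Q : Set (Query S)) (U : Machine) :
    ComputablePred fun w => (Theta 𝒟 Q U w).Dom := by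
  have h1 : PrimrecPred fun w : List Bool => ∃ n ∈ List.range (ofStr w),
      str (Encodable.encode (U.curry n)) = w := by
    refine primrecPred_exists_mem (by fun_prop) (primrecPred_eq (primrec_str (primrec_encode
      (primrec_curry U (by fun_prop)))) (by fun_prop))
  refine h1.computablePred.of_eq fun w => ⟨?_, ?_⟩
  · rintro ⟨n, -, rfl⟩
    exact ⟨Denumerable.ofNat Machine n, by simp [machineStr, star]⟩
  · rintro ⟨M, rfl⟩
    refine ⟨Encodable.encode M, ?_, rfl⟩
    rw [List.mem_range, machineStr, ofStr_str]
    exact lt_encode_curry _ _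

theorem isKRF_theta (h𝒟 : 𝒟 = allDatabases S ∨ 𝒟 = positiveDatabases S)
    (hQ : IsQueryLanguage Q) {U : Machine} (hU : Implements 𝒟 Q U) :
    IsKRF 𝒟 Q (Theta 𝒟 Q U) := by
  refine ⟨computablePred_theta_dom 𝒟 Q U, fun w K hK => ?_, ?_⟩
  · obtain ⟨M, -, rfl⟩ := mem_theta.1 hK
    exact isKB_machineKB h𝒟 hQ hU M
  · have h1 : REPred fun x : List Bool × List Bool => ∃ y : ℕ × ℕ × ℕ,
        (∃ D ∈ 𝒟, D.code = y.1) ∧ (∃ φ ∈ Q, queryCode φ = y.2.1) ∧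
        x.2 = str (Nat.pair y.1 y.2.1) ∧ str (Encodable.encode (U.curry y.2.2)) = x.1 ∧
        Accepts (U.curry y.2.2) x.2 := by
      refine REPred.exists (REPred.and ?_ (REPred.and ?_ (REPred.and ?_ (REPred.and ?_ ?_))))
      · exact (rePred_exists_code_eq h𝒟).comp
          (f := fun x : (List Bool × List Bool) × ℕ × ℕ × ℕ => x.2.1) (by fun_prop)
      · exact (rePred_isQueryCode hQ).comp
          (f := fun x : (List Bool × List Bool) × ℕ × ℕ × ℕ => x.2.2.1) (by fun_prop)
      · exact PrimrecPred.rePred (by fun_prop)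
      · exact PrimrecPred.rePred (primrecPred_eq (primrec_str (primrec_encode
          (primrec_curry U (by fun_prop)))) (by fun_prop))
      · exact rePred_accepts (primrec_curry U (by fun_prop)) (by fun_prop)
    refine h1.of_eq fun x => ⟨?_, ?_⟩
    · rintro ⟨⟨d, q, n⟩, ⟨D, hD, rfl⟩, ⟨φ, hφ, rfl⟩, hx, hw, ha⟩
      have hn : star U (Denumerable.ofNat Machine n) = U.curry n := by simp [star]
      refine ⟨D, hD, φ, hφ, hx, machineKB 𝒟 Q (U.curry n), ?_, hD, hφ, ?_⟩
      · exact mem_theta.2 ⟨Denumerable.ofNat Machine n, by rw [hn]; exact hw, by rw [hn]⟩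
      · rw [hx] at ha
        exact ha
    · rintro ⟨D, hD, φ, hφ, hx, K, hK, hDφ⟩
      obtain ⟨M, hM, rfl⟩ := mem_theta.1 hK
      refine ⟨(D.code, queryCode φ, Encodable.encode M), ⟨D, hD, rfl⟩, ⟨φ, hφ, rfl⟩, hx, hM, ?_⟩
      rw [hx]
      exact hDφ.2.2

/-! ### Universality -/

/-- The procedure generates a least closed class, so it adds nothing to a KB that contains the pairs
accepted by `M`. Rule (vi) is inverted by renaming back with `ρ`. -/
theorem IsKB.mem_of_procedureAccepts (h𝒟 : 𝒟 = allDatabases S ∨ 𝒟 = positiveDatabases S)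
    (hQ : IsQueryLanguage Q) {K : Set (Database S × Query S)} (hK : IsKB 𝒟 Q K) {M : Machine}
    (hM : ∀ D ∈ 𝒟, ∀ φ ∈ Q, Accepts M (pairStr D φ) → (D, φ) ∈ K) {D : Database S} {φ : Query S}
    (h : ProcedureAccepts 𝒟 Q M D φ) (hD : D ∈ 𝒟) (hφ : φ ∈ Q) : (D, φ) ∈ K := by
  induction h with
  | simulate D φ h => exact hM D hD φ hφ h
  | tautology D φ h => exact hK.tautology D hD φ hφ h
  | implication D φ ψ hψ h _ ih => exact hK.implication D ψ (ih hD hψ) φ hφ h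
  | conj D ψ χ hψ hχ _ _ ih1 ih2 => exact hK.conj D ψ χ (ih1 hD hψ) (ih2 hD hχ)
  | extension D D' φ hD' h _ ih => exact hK.extension D' φ (ih hD' hφ) D hD h
  | rename τ D φ hτ _ ih =>
    obtain ⟨N, hN⟩ := exists_bound_database D
    obtain ⟨N', hN'⟩ := exists_bound_tokens (formulaTokens φ)
    obtain ⟨ρ, hρ, hρτ⟩ := exists_rename_leftInverse hτ (N + N')
    have h1 := hK.rename ρ hρ _ _ (ih (rename_mem h𝒟 hτ hD) (hQ.rename τ hτ φ hφ))
    rw [database_rename_rename_eq_self hτ hρ fun e he c hc =>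
      hρτ c ((hN e he c hc).trans_le (Nat.le_add_right _ _))] at h1
    refine hK.implication D _ h1 φ hφ (implies_of_formulaTokens_eq ?_)
    rw [formulaTokens_renameQuery, formulaTokens_renameQuery]
    exact map_renameToken_eq_self fun c hc =>
      hρτ _ ((hN' c hc).trans_le (Nat.le_add_left _ _))

theorem pairStr_eq_iff {D D' : Database S} {φ φ' : Query S} (h : pairStr D φ = pairStr D' φ') :
    D = D' ∧ formulaTokens φ = formulaTokens φ' := by
  obtain ⟨h1, h2⟩ := Nat.pair_eq_pair.1 (str_injective h)
  exact ⟨database_code_injective h1, Encodable.encode_injective h2⟩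

theorem IsKRF.reducibleTo_theta (h𝒟 : 𝒟 = allDatabases S ∨ 𝒟 = positiveDatabases S)
    (hQ : IsQueryLanguage Q) {U : Machine} (hU : Implements 𝒟 Q U)
    {Γ : List Bool →. Set (Database S × Query S)} (hΓ : IsKRF 𝒟 Q Γ) :
    ReducibleTo Γ (Theta 𝒟 Q U) := by
  obtain ⟨c, hc⟩ := exists_machine_of_rePred (hΓ.re.comp
    (f := fun n : ℕ => ((Encodable.decode n.unpair.1 : Option (List Bool)).getD [],
      (Encodable.decode n.unpair.2 : Option (List Bool)).getD [])) (by fun_prop))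
  -- By the s-m-n theorem, `π` is turned effectively into a machine for the pairs in `Γ(π)`.
  let N : List Bool → Machine := fun π => c.curry (Encodable.encode π)
  have hN : ∀ π w, Accepts (N π) w ↔
      ∃ D ∈ 𝒟, ∃ φ ∈ Q, w = pairStr D φ ∧ ∃ K ∈ Γ π, (D, φ) ∈ K := fun π w => by
    rw [Accepts, Nat.Partrec.Code.eval_curry, hc]
    simp only [Nat.unpair_pair, Encodable.encodek, Option.getD_some]
  have hKB : ∀ π K, K ∈ Γ π → machineKB 𝒟 Q (star U (N π)) = K := by
    intro π K hK
    have hKB := hΓ.kb π K hK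
    ext ⟨D, φ⟩
    constructor
    · rintro ⟨hD, hφ, h⟩
      refine hKB.mem_of_procedureAccepts h𝒟 hQ (fun D hD φ hφ h => ?_)
        ((hU _ D hD φ hφ).1 h) hD hφ
      obtain ⟨D', hD', φ', hφ', hw, K', hK', hmem⟩ := (hN π _).1 h
      -- The accepted string determines the database, but the sentence only up to its tokens;
      -- closure of the KB under implication covers the rest.
      obtain ⟨rfl, ht⟩ := pairStr_eq_iff hw
      rw [Part.mem_unique hK' hK] at hmem
      exact hKB.implication _ _ hmem φ hφ (implies_of_formulaTokens_eq ht.symm)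
    · intro h
      have h1 := hKB.subclass h
      exact ⟨h1.1, h1.2, (hU _ D h1.1 φ h1.2).2
        (.simulate D φ ((hN π _).2 ⟨D, h1.1, φ, h1.2, rfl, K, hK, h⟩))⟩
  let g : List Bool → List Bool := fun π => machineStr (star U (N π))
  have hg : Primrec g := by
    refine primrec_str (primrec_encode (primrec_curry U (primrec_encode (primrec_curry c ?_))))
    fun_prop
  -- The total function `g` is cut down to the domain of `Γ`, as `Γ = Θ ∘ p` must hold for partial
  -- functions.
  let p : List Bool →. List Bool := fun π =>
    (Part.assert (Γ π).Dom fun _ => Part.some ()).map fun _ => g π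
  have hdom : ∀ π, (p π).Dom ↔ (Γ π).Dom := fun π =>
    ⟨fun ⟨h, _⟩ => h, fun h => ⟨h, trivial⟩⟩
  have hp : ∀ π ω, ω ∈ p π ↔ (Γ π).Dom ∧ g π = ω := fun π ω => by simp [p]
  refine ⟨p, ?_, ?_, hdom, ?_, ?_⟩
  · exact Partrec.map hΓ.dom_recursive.to_re (hg.comp Primrec.fst).to_comp.to₂
  · exact hΓ.dom_recursive.of_eq fun π => (hdom π).symm
  · intro π ω hω
    obtain ⟨-, rfl⟩ := (hp π ω).1 hω
    exact ⟨N π, rfl⟩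
  · refine PFun.ext fun π K => ?_
    refine Iff.trans ?_ Part.mem_bind_iff.symm
    constructor
    · intro hK
      refine ⟨g π, (hp π _).2 ⟨Part.dom_iff_mem.2 ⟨K, hK⟩, rfl⟩, ?_⟩
      exact mem_theta.2 ⟨N π, rfl, (hKB π K hK).symm⟩
    · rintro ⟨ω, hω, hK⟩
      obtain ⟨hd, rfl⟩ := (hp π ω).1 hω
      have h1 := hKB π _ (Part.get_mem hd)
      change K ∈ Theta 𝒟 Q U (machineStr (star U (N π))) at hK
      rw [theta_machineStr, Part.mem_some_iff, h1] at hK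
      rw [hK]
      exact Part.get_mem hd

theorem ReducibleTo.trans {Γ Γ₀ Γ₁ : List Bool →. Set (Database S × Query S)}
    (h : ReducibleTo Γ Γ₀) (h' : ReducibleTo Γ₀ Γ₁) : ReducibleTo Γ Γ₁ := by
  obtain ⟨p, hp, hpc, hpd, hpr, rfl⟩ := h
  obtain ⟨r, hr, -, hrd, hrr, rfl⟩ := h'
  have hdom : ∀ π, ((r.comp p) π).Dom ↔ (p π).Dom := fun π =>
    ⟨fun ⟨h, _⟩ => h, fun h => ⟨h, (hrd _).2 (hpr π _ (Part.get_mem h))⟩⟩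
  refine ⟨r.comp p, ?_, hpc.of_eq fun π => (hdom π).symm, fun π => (hdom π).trans (hpd π), ?_, ?_⟩
  · exact Partrec.bind hp (hr.comp Computable.snd).to₂
  · intro π ω hω
    obtain ⟨ω', -, hω⟩ := Part.mem_bind_iff.1 hω
    exact hrr ω' ω hω
  · rw [PFun.comp_assoc]

end KRep

theorem mainTheorem7 (S : KRep.Signatures)
    (𝒟 : Set (KRep.Database S))
    (h𝒟 : 𝒟 = KRep.allDatabases S ∨ 𝒟 = KRep.positiveDatabases S)
    (Q : Set (KRep.Query S)) (hQ : KRep.IsQueryLanguage Q) :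
    (∃ U : KRep.Machine, KRep.Implements 𝒟 Q U) ∧
    ∀ U : KRep.Machine, KRep.Implements 𝒟 Q U →
      KRep.IsKRF 𝒟 Q (KRep.Theta 𝒟 Q U) ∧
      ∀ Γ : List Bool →. Set (KRep.Database S × KRep.Query S), KRep.IsKRF 𝒟 Q Γ →
        (KRep.IsUniversal 𝒟 Q Γ ↔ KRep.ReducibleTo (KRep.Theta 𝒟 Q U) Γ) := by
  refine ⟨KRep.exists_implements h𝒟 hQ, fun U hU => ⟨KRep.isKRF_theta h𝒟 hQ hU, fun Γ hΓ => ?_⟩⟩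
  exact ⟨fun h => h.2 _ (KRep.isKRF_theta h𝒟 hQ hU),
    fun h => ⟨hΓ, fun Γ' hΓ' => (hΓ'.reducibleTo_theta h𝒟 hQ hU).trans h⟩⟩
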